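/- Let $G$ be a finite connected plane graph (loops and parallel edges are allowed), let $s\neq t$ be two vertices of $G$, and let $G^*$ be the dual graph, with edges of length 1. Choose a face $f_s$ of $G$ incident to $s$ and a face $f_t$ incident to $t$, together with a corner of $f_s$ at $s$ and a corner of $f_t$ at $t$. Let $\pi$ be a shortest path $v_0v_1\cdots v_k$ in $G^*$ from $v_0=f_s^*$ to $v_k=f_t^*$. Cut $G^*$ along $\pi$, where the cut enters $v_0$ through the chosen corner in the dual face $s^*$ and leaves $v_k$ through the chosen corner in the dual face $t^*$: each $v_i$ is split into two vertices $x_i$, $y_i$, where $x_i$ keeps the edges of $G^*$ on the right of $\pi$ (directed from $v_0$ to $v_k$) and $y_i$ those on its left, and each edge of $\pi$ is doubled into a copy joining consecutive $x_i$'s and a copy joining consecutive $y_i$'s. The result is a connected plane graph $G^c$ with all $x_i$, $y_i$ on the outer face. Let $K$ be the set of indices $i\in\{0,\dots,k\}$ for which $\mathrm{dist}(x_i,y_i)$, the distance in $G^c$, is minimum. For an index $i$, the leftmost shortest $(x_i,y_i)$-path $\pi_i^\ell$ is the path from $x_i$ to $y_i$ in the tree of the breadth-first visit of $G^c$ from $x_i$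 that scans the edges at each vertex in counterclockwise order, starting just after the edge through which that vertex was reached (at $x_i$: starting from the outer face). The rightmost shortest path $\pi_i^r$ is defined in the same way with clockwise order. A path from $x_i$ to $y_i$ divides $G^c$ into a left side, containing the $x_j,y_j$ with $j<i$, and a right side, containing those with $j>i$; both sides include the path. Let $G_i^\ell$ be the subgraph of $G^c$ induced by the vertices on the left side of $\pi_i^\ell$, let $G_i^r$ be the subgraph induced by the vertices on the right side of $\pi_i^r$, and let $\Pi_i$ be the subgraph induced by the vertices that lie both on the right side of $\pi_i^\ell$ and on the left side of $\pi_i^r$. Then, for every $i\in K$: (i) for every $j>i$, every shortest $(x_j,y_j)$-path in $G^c$ is contained in $G_i^r\cup\Pi_i$; (ii) for all vertices $u,v$ of $G_i^r$, the distance between $u$ and $v$ in $G_i^r\cup\Pi_i$ equals their distance in $G_i^r$; (iii) for every $j$, every subpath of a shortest $(x_j,y_j)$-path of $G^c$ that is contained in $\Pi_i$ is also a subpath of some shortest $(x_i,y_i)$-path of $G^c$. -/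

import Mathlib

/-- A combinatorial map: a graph (loops and parallel edges allowed, no isolated vertices) drawn on
an oriented surface. Every edge consists of two darts (its two orientations), exchanged by `rev`;
`rot` sends a dart to the next dart, in counterclockwise order, with the same tail. -/
structure CombMap (D : Type*) where
  rot : Equiv.Perm D
  rev : Equiv.Perm D
  rev_rev : ∀ d, rev (rev d) = d
  rev_ne : ∀ d, rev d ≠ d

namespace CombMap

variable {D : Type*}

/-- The face permutation: it follows the boundary of the face on the left of a dart. -/
def face (M : CombMap D) : Equiv.Perm D := M.rot⁻¹ * M.rev

/-- The vertices are the cycles of `rot`. -/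
def Vert (M : CombMap D) : Type _ := Quotient (Equiv.Perm.SameCycle.setoid M.rot)

/-- The edges are the cycles of `rev`. -/
def Edge (M : CombMap D) : Type _ := Quotient (Equiv.Perm.SameCycle.setoid M.rev)

/-- The faces are the cycles of `face`. -/
def Face (M : CombMap D) : Type _ := Quotient (Equiv.Perm.SameCycle.setoid M.face)

/-- The vertex a dart starts from. -/
def tail (M : CombMap D) (d : D) : M.Vert := Quotient.mk _ d

/-- The vertex a dart leads to. -/
def head (M : CombMap D) (d : D) : M.Vert := M.tail (M.rev d)

/-- `M.IsWalk u l v`: the darts of `l` form a walk from `u` to `v`. -/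
def IsWalk (M : CombMap D) : M.Vert → List D → M.Vert → Prop
  | u, [], v => u = v
  | u, d :: l, v => M.tail d = u ∧ M.IsWalk (M.head d) l v

/-- The vertices visited by the walk that starts at `u` and follows the darts of `l`. -/
def support (M : CombMap D) (u : M.Vert) (l : List D) : List M.Vert := u :: l.map M.head

/-- `l` is a shortest path from `u` to `v`. -/
def IsShortest (M : CombMap D) (u : M.Vert) (l : List D) (v : M.Vert) : Prop :=
  M.IsWalk u l v ∧ ∀ l', M.IsWalk u l' v → l.length ≤ l'.length

def Connected (M : CombMap D) : Prop := ∀ u v : M.Vert, ∃ l, M.IsWalk u l v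

/-- A connected plane graph: a connected map that satisfies Euler's formula `V - E + F = 2`. -/
def IsPlane (M : CombMap D) : Prop :=
  M.Connected ∧ Nat.card M.Vert + Nat.card M.Face = Nat.card M.Edge + 2

/-- The dual map. Its vertices are the faces of `M`; the dart `d` of the dual crosses the edge of
the dart `d` of `M` from the face on the left of `d` to the face on the right of `d`. -/
def dual (M : CombMap D) : CombMap D where
  rot := M.face
  rev := M.rev
  rev_rev := M.rev_rev
  rev_ne := M.rev_ne

/-! ### Subgraphs -/

/-- A set of vertices and a set of darts. -/
structure Sub (M : CombMap D) where
  verts : Set M.Vert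
  darts : Set D

/-- The subgraph induced by a set of vertices. -/
def induce (M : CombMap D) (S : Set M.Vert) : M.Sub where
  verts := S
  darts := {d | M.tail d ∈ S ∧ M.head d ∈ S}

instance (M : CombMap D) : Union M.Sub where
  union H K := ⟨H.verts ∪ K.verts, H.darts ∪ K.darts⟩

/-- `l` is a walk from `u` to `v` contained in the subgraph `H`. -/
def Sub.IsWalk {M : CombMap D} (H : M.Sub) (u : M.Vert) (l : List D) (v : M.Vert) : Prop :=
  M.IsWalk u l v ∧ (∀ w ∈ M.support u l, w ∈ H.verts) ∧ ∀ d ∈ l, d ∈ H.darts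

/-- The distance in the subgraph `H`: the least length of a walk in `H`, `⊤` if there is none. -/
noncomputable def Sub.dist {M : CombMap D} (H : M.Sub) (u v : M.Vert) : ℕ∞ :=
  ⨅ (l : List D) (_ : H.IsWalk u l v), (l.length : ℕ∞)

/-- The distance in the whole graph. -/
noncomputable def dist (M : CombMap D) (u v : M.Vert) : ℕ∞ := (M.induce Set.univ).dist u v

/-! ### Breadth-first visits guided by the rotation -/

/-- The dart by which one looks back from the end of the path `P`: the reverse of the last dart of
`P`, and the reference dart `r` of the root if `P` is empty. -/
def back (M : CombMap D) (r : D) (P : List D) : D := (P.getLast?.map M.rev).getD r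

/-- The cycle of `ρ` through `r`, listed from `ρ r` to `r`. -/
noncomputable def cycleFrom (ρ : Equiv.Perm D) (r : D) : List D :=
  (List.range (Function.minimalPeriod ρ r)).map fun m => (ρ ^ (m + 1)) r

/-- The breadth-first visit from the tail of `r`, after `n` vertices have been processed. The value
lists, in order of discovery, the tree paths from the root to the vertices discovered so far; the
entries from index `n` on form the queue. The neighbours of the vertex in process are scanned in the
order of the rotation `ρ`, starting from the dart that follows the one leading back to the vertex
from which it was reached (for the root: starting from `ρ r`). -/
noncomputable def bfs (M : CombMap D) (ρ : Equiv.Perm D) (r : D) : ℕ → List (List D)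
  | 0 => [[]]
  | n + 1 =>
    match (M.bfs ρ r n)[n]? with
    | none => M.bfs ρ r n
    | some P =>
      (cycleFrom ρ (M.back r P)).foldl
        (fun F d =>
          open Classical in
          if ∃ Q ∈ F, M.tail (M.back r Q) = M.head d then F else F ++ [P ++ [d]])
        (M.bfs ρ r n)

/-- The path from the tail of `r` to `v` in the tree of the complete breadth-first visit. -/
noncomputable def bfsPath (M : CombMap D) (ρ : Equiv.Perm D) (r : D) (v : M.Vert) : List D :=
  open Classical in
  ((M.bfs ρ r (Nat.card D)).find? fun P => M.tail (M.back r P) = v).getD []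

/-! ### The two sides of a path between two vertices of the outer face -/

/-- The darts met when turning by `ρ` from the dart `b`, strictly after `b` and strictly before
`o` (all the darts other than `b` if `o = b`). -/
def arc (ρ : Equiv.Perm D) (b o : D) : Set D :=
  {d | d ≠ b ∧ ∃ n : ℕ, d = (ρ ^ (n + 1)) b ∧ ∀ m ≤ n, (ρ ^ (m + 1)) b ≠ o}

/-- The darts that leave the path `P` on one side: at each vertex of `P`, those that lie, in the
order of `ρ`, between the dart back along `P` and the dart forward along `P`. At the first vertex of
`P`, the scan starts after `r`; at its last vertex, it stops before `e`. -/
def sideDarts (M : CombMap D) (ρ : Equiv.Perm D) (r e : D) (P : List D) : Set D :=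
  {d | ∃ q ∈ List.zip (r :: P.map M.rev) (P ++ [e]), d ∈ arc ρ q.1 q.2}

/-- The vertices on one side of the path `P`, including those of `P`: the vertices of `P` and the
vertices reached by walks that leave `P` on that side and do not meet `P` again. -/
def side (M : CombMap D) (ρ : Equiv.Perm D) (r e : D) (P : List D) : Set M.Vert :=
  {w | w ∈ M.support (M.tail r) P ∨
    ∃ d ∈ M.sideDarts ρ r e P, ∃ l, M.IsWalk (M.head d) l w ∧
      ∀ z ∈ M.support (M.head d) l, z ∉ M.support (M.tail r) P}

/-! ### Cutting a map along a path

`H` is a map, `p` a path of `H` given by its darts `p₀, …, pₖ₋₁`, and `ds`, `dt` are darts at the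
first and at the last vertex of the path. The cut enters the first vertex through the corner between
`rot⁻¹ ds` and `ds`, follows `p`, and leaves the last vertex through the corner between `rot⁻¹ dt`
and `dt`. -/

section Cut

variable (H : CombMap D) (p : List D) (ds dt : D)

/-- The darts of the edges of `p`. -/
abbrev PathDart : Type _ := {d : D // d ∈ p ∨ H.rev d ∈ p}

/-- The darts of the cut map: the edges of `p` are doubled. For an edge of `p`, `Sum.inl` is the copy
on the left of `p` and `Sum.inr` is the copy on the right of `p`. -/
abbrev CutDart : Type _ := D ⊕ H.PathDart p

/-- Reversal of the darts of the edges of `p`. -/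
def pathRev : Equiv.Perm (H.PathDart p) where
  toFun d := ⟨H.rev d.1, d.2.elim (fun h => Or.inr (by rwa [H.rev_rev])) Or.inl⟩
  invFun d := ⟨H.rev d.1, d.2.elim (fun h => Or.inr (by rwa [H.rev_rev])) Or.inl⟩
  left_inv d := Subtype.ext (H.rev_rev d.1)
  right_inv d := Subtype.ext (H.rev_rev d.1)

/-- Exchanges the two copies of the darts of `p` that belong to `S`. -/
noncomputable def exchange (S : Set D) : Equiv.Perm (H.CutDart p) :=
  open Classical in
  Function.Involutive.toPerm
    (fun x => match x with
      | Sum.inl d =>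
        if h : (d ∈ p ∨ H.rev d ∈ p) ∧ d ∈ S then Sum.inr ⟨d, h.1⟩ else Sum.inl d
      | Sum.inr d => if d.1 ∈ S then Sum.inl d.1 else Sum.inr d)
    (by
      rintro (d | d)
      · by_cases h : (d ∈ p ∨ H.rev d ∈ p) ∧ d ∈ S
        · simp [h]
        · simp [h]
      · by_cases h : d.1 ∈ S
        · simp [h, d.2]
        · simp [h])

/-- The rotation after every edge of `p` has been replaced by two parallel edges: around the tail of
a dart `d` of `p`, the right copy of `d` comes just before the left copy; around its head, the right
copy of `rev d` comes just after the left copy. -/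
noncomputable def doubledRot : Equiv.Perm (H.CutDart p) :=
  H.exchange p {d | d ∈ p} * Equiv.sumCongr H.rot 1 * H.exchange p {d | H.rev d ∈ p}

/-- The dart that precedes, around the `i`-th vertex of the path, the corner through which the cut
enters: the corner between the two copies of `rev pᵢ₋₁`, or the corner before `ds` if `i = 0`. -/
noncomputable def enter (i : Fin (p.length + 1)) : H.CutDart p :=
  Fin.cases (H.exchange p {d | H.rev d ∈ p} (Sum.inl (H.rot⁻¹ ds)))
    (fun j => Sum.inl (H.rev (p.get j))) i

/-- The dart that precedes, around the `i`-th vertex of the path, the corner through which the cut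
leaves: the corner between the two copies of `pᵢ`, or the corner before `dt` if `i = k`. -/
noncomputable def leave (i : Fin (p.length + 1)) : H.CutDart p :=
  Fin.lastCases (motive := fun _ => H.CutDart p)
    (H.exchange p {d | H.rev d ∈ p} (Sum.inl (H.rot⁻¹ dt)))
    (fun j => Sum.inr ⟨p.get j, Or.inl (List.get_mem p j)⟩) i

/-- The map cut along `p`: after the edges of `p` have been doubled, each vertex of `p` is split
along the line from the corner where the cut enters to the corner where it leaves. (Composing a
rotation with the transposition of `a` and `b` splits the cycle through `a` and `b` at the corners
after `a` and after `b`.) -/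
noncomputable def cut : CombMap (H.CutDart p) where
  rot := open Classical in
    H.doubledRot p * (List.ofFn fun i => Equiv.swap (H.enter p ds i) (H.leave p dt i)).prod
  rev := Equiv.sumCongr H.rev (H.pathRev p)
  rev_rev := by
    rintro (d | d)
    · simp [H.rev_rev]
    · simp [pathRev, H.rev_rev]
  rev_ne := by
    rintro (d | d)
    · simp [H.rev_ne]
    · simp [pathRev, Subtype.ext_iff, H.rev_ne]

/-- The copy on the right of `p` of the `i`-th vertex of the path. In the cut map its outer corner
lies just after the dart `leave i`. -/
noncomputable def x (i : Fin (p.length + 1)) : (H.cut p ds dt).Vert :=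
  (H.cut p ds dt).tail (H.leave p dt i)

/-- The copy on the left of `p` of the `i`-th vertex of the path. In the cut map its outer corner
lies just after the dart `enter i`. -/
noncomputable def y (i : Fin (p.length + 1)) : (H.cut p ds dt).Vert :=
  (H.cut p ds dt).tail (H.enter p ds i)

/-- The set of the indices `i` for which the distance from `xᵢ` to `yᵢ` is minimum. -/
def minIndices : Set (Fin (p.length + 1)) :=
  {i | ∀ m, (H.cut p ds dt).dist (H.x p ds dt i) (H.y p ds dt i) ≤
    (H.cut p ds dt).dist (H.x p ds dt m) (H.y p ds dt m)}

/-- The leftmost shortest path from `xᵢ` to `yᵢ`: the path of the breadth-first visit in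
counterclockwise order, where the scan at the root starts from the outer corner. -/
noncomputable def leftmost (i : Fin (p.length + 1)) : List (H.CutDart p) :=
  (H.cut p ds dt).bfsPath (H.cut p ds dt).rot (H.leave p dt i) (H.y p ds dt i)

/-- The rightmost shortest path from `xᵢ` to `yᵢ`: the path of the breadth-first visit in
clockwise order, where the scan at the root starts from the outer corner. -/
noncomputable def rightmost (i : Fin (p.length + 1)) : List (H.CutDart p) :=
  (H.cut p ds dt).bfsPath (H.cut p ds dt).rot⁻¹ ((H.cut p ds dt).rot (H.leave p dt i))
    (H.y p ds dt i)

/-- The vertices on a path `P` from `xᵢ` to `yᵢ` or to its left, the side of the `xⱼ`, `yⱼ` with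
`j < i`. -/
def leftSide (i : Fin (p.length + 1)) (P : List (H.CutDart p)) : Set (H.cut p ds dt).Vert :=
  (H.cut p ds dt).side (H.cut p ds dt).rot (H.leave p dt i)
    ((H.cut p ds dt).rot (H.enter p ds i)) P

/-- The vertices on a path `P` from `xᵢ` to `yᵢ` or to its right, the side of the `xⱼ`, `yⱼ` with
`j > i`. -/
def rightSide (i : Fin (p.length + 1)) (P : List (H.CutDart p)) : Set (H.cut p ds dt).Vert :=
  (H.cut p ds dt).side (H.cut p ds dt).rot⁻¹ ((H.cut p ds dt).rot (H.leave p dt i))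
    (H.enter p ds i) P

/-- The subgraph to the left of the leftmost shortest path from `xᵢ` to `yᵢ`. -/
noncomputable def leftPart (i : Fin (p.length + 1)) : (H.cut p ds dt).Sub :=
  (H.cut p ds dt).induce (H.leftSide p ds dt i (H.leftmost p ds dt i))

/-- The subgraph between the leftmost and the rightmost shortest path from `xᵢ` to `yᵢ`. -/
noncomputable def middlePart (i : Fin (p.length + 1)) : (H.cut p ds dt).Sub :=
  (H.cut p ds dt).induce
    (H.rightSide p ds dt i (H.leftmost p ds dt i) ∩ H.leftSide p ds dt i (H.rightmost p ds dt i))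

/-- The subgraph to the right of the rightmost shortest path from `xᵢ` to `yᵢ`. -/
noncomputable def rightPart (i : Fin (p.length + 1)) : (H.cut p ds dt).Sub :=
  (H.cut p ds dt).induce (H.rightSide p ds dt i (H.rightmost p ds dt i))

end Cut

end CombMap

/-! Everything takes place in the cut map. The darts `leave i` and `enter i` precede the outer
corners at x_i and y_i, and one face meets the first family in increasing and the second in
decreasing order. Together with connectivity and Euler's inequality E + 2 ≤ V + F, this is the
structure `IsSlit`, which is all that the argument on shortest paths uses of the cut. It holds
(`IsCutPath.isSlit`) because cutting along a path of k edges adds at least k + 1 vertices and at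
most k edges, and loses at most one face: the faces s* and t*, distinct since s ≠ t, merge.

Planarity enters through a Jordan curve theorem (`IsSlit.exists_separation`), proved by linear
algebra over ℚ. Coboundaries of vertex functions and boundaries of face functions are orthogonal, so
Euler's inequality and a dimension count show that, together with the edge functions, they span all
functions of the darts. Hence an antisymmetric function with zero sum around every face is a
coboundary (`exists_potential`). Applied to the signed number of times a dart leaves a simple path
on its first side, this yields a vertex function that, off the path, is 1 on one side and 0 on the
other; following the outer face gives its values at all x_m and y_m.

The breadth-first visit finds, for each vertex, the walk that is least by length and then
lexicographically by scan positions (`bfsPath_spec`). So no shortest (x_i, y_i)-path leaves π_i^ℓ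
towards its left.

(i) If a shortest (x_j, y_j)-path with j > i went to the left of π_i^ℓ, it would have to come back
to π_i^ℓ; splicing the excursion into π_i^ℓ would give a shortest (x_i, y_i)-path that strays to the
left. (ii) An excursion out of the right side of π_i^r can be replaced by a segment of π_i^r that is
no longer. (iii) Let π be π_i^r if j > i and π_i^ℓ if j < i. The parts of the (x_j, y_j)-path before
and after the given subpath meet π, at a and at b. If a comes before b on π, the stretch from a to b
can be spliced into π without changing its length. If b comes strictly before a, then exchanging the
final parts of the two paths gives walks from x_i to y_j and from x_j to y_i; by planarity they
share a vertex z, and wherever z lies, this contradicts that both original paths are shortest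
(`IsSlit.exists_shortest_through`). -/

namespace CombMap

variable {D : Type*} {M : CombMap D}

/-! ### Walks -/

theorem tail_eq_tail {d e : D} : M.tail d = M.tail e ↔ M.rot.SameCycle d e :=
  ⟨fun h => Quotient.exact h, fun h => Quotient.sound h⟩

theorem tail_rot (d : D) : M.tail (M.rot d) = M.tail d :=
  tail_eq_tail.2 (Equiv.Perm.sameCycle_apply_left.2 (Equiv.Perm.SameCycle.refl _ _))

theorem tail_rot_inv (d : D) : M.tail (M.rot⁻¹ d) = M.tail d :=
  tail_eq_tail.2 (Equiv.Perm.sameCycle_symm_apply_left.2 (Equiv.Perm.SameCycle.refl _ _))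

theorem tail_rev (d : D) : M.tail (M.rev d) = M.head d := rfl

theorem head_rev (d : D) : M.head (M.rev d) = M.tail d := by
  rw [head, M.rev_rev]

theorem tail_surjective (v : M.Vert) : ∃ d, M.tail d = v := Quotient.exists_rep v

theorem tail_face (d : D) : M.tail (M.face d) = M.head d := tail_rot_inv _

@[simp] theorem isWalk_nil {u v : M.Vert} : M.IsWalk u [] v ↔ u = v := Iff.rfl

@[simp] theorem isWalk_cons {u v : M.Vert} {d : D} {l : List D} :
    M.IsWalk u (d :: l) v ↔ M.tail d = u ∧ M.IsWalk (M.head d) l v := Iff.rfl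

theorem isWalk_append {u v : M.Vert} {l l' : List D} :
    M.IsWalk u (l ++ l') v ↔ ∃ w, M.IsWalk u l w ∧ M.IsWalk w l' v := by
  induction l generalizing u with
  | nil => simp
  | cons d l ih => simp [ih, and_assoc]

theorem IsWalk.append {u v w : M.Vert} {l l' : List D} (h : M.IsWalk u l w)
    (h' : M.IsWalk w l' v) : M.IsWalk u (l ++ l') v := isWalk_append.2 ⟨w, h, h'⟩

theorem isWalk_singleton {u v : M.Vert} {d : D} :
    M.IsWalk u [d] v ↔ M.tail d = u ∧ M.head d = v := by simp

@[simp] theorem support_nil (u : M.Vert) : M.support u [] = [u] := rfl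

@[simp] theorem support_cons (u : M.Vert) (d : D) (l : List D) :
    M.support u (d :: l) = u :: M.support (M.head d) l := rfl

theorem start_mem_support (u : M.Vert) (l : List D) : u ∈ M.support u l := by simp [support]

theorem IsWalk.end_mem_support {u v : M.Vert} {l : List D} (h : M.IsWalk u l v) :
    v ∈ M.support u l := by
  induction l generalizing u with
  | nil => simp [isWalk_nil.1 h]
  | cons d l ih => exact List.mem_cons_of_mem _ (ih h.2)

theorem IsWalk.mem_support_append {u w z : M.Vert} {l l' : List D} (h : M.IsWalk u l w) :
    z ∈ M.support u (l ++ l') ↔ z ∈ M.support u l ∨ z ∈ M.support w l' := by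
  induction l generalizing u with
  | nil =>
    cases isWalk_nil.1 h
    simp only [List.nil_append, support_nil, List.mem_singleton, iff_or_self]
    rintro rfl
    exact start_mem_support _ _
  | cons d l ih => simp [ih h.2, or_assoc]

theorem IsWalk.split {u v w : M.Vert} {l : List D} (h : M.IsWalk u l v)
    (hw : w ∈ M.support u l) : ∃ A B, l = A ++ B ∧ M.IsWalk u A w ∧ M.IsWalk w B v := by
  induction l generalizing u with
  | nil =>
    have : w = u := by simpa using hw
    exact ⟨[], [], rfl, this.symm, this ▸ h⟩
  | cons d l ih =>
    rcases List.mem_cons.1 hw with rfl | hw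
    · exact ⟨[], d :: l, rfl, rfl, h⟩
    · obtain ⟨A, B, rfl, hA, hB⟩ := ih h.2 hw
      exact ⟨d :: A, B, rfl, ⟨h.1, hA⟩, hB⟩

theorem IsWalk.tail_mem_support {u v : M.Vert} {l : List D} (h : M.IsWalk u l v) {d : D}
    (hd : d ∈ l) : M.tail d ∈ M.support u l := by
  induction l generalizing u with
  | nil => simp at hd
  | cons e l ih =>
    rcases List.mem_cons.1 hd with rfl | hd
    · simp [h.1]
    · exact List.mem_cons_of_mem _ (ih h.2 hd)

theorem head_mem_support {u : M.Vert} {l : List D} {d : D} (hd : d ∈ l) :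
    M.head d ∈ M.support u l := List.mem_cons_of_mem _ (List.mem_map_of_mem hd)

/-- The reverse of a walk. -/
def revWalk (M : CombMap D) (l : List D) : List D := (l.map M.rev).reverse

@[simp] theorem length_revWalk (l : List D) : (M.revWalk l).length = l.length := by simp [revWalk]

theorem revWalk_cons (d : D) (l : List D) : M.revWalk (d :: l) = M.revWalk l ++ [M.rev d] := by
  simp [revWalk]

theorem IsWalk.revWalk {u v : M.Vert} {l : List D} (h : M.IsWalk u l v) :
    M.IsWalk v (M.revWalk l) u := by
  induction l generalizing u with
  | nil => exact (isWalk_nil.1 h).symm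
  | cons d l ih =>
    rw [revWalk_cons]
    exact (ih h.2).append (isWalk_singleton.2 ⟨rfl, (head_rev d).trans h.1⟩)

theorem IsWalk.mem_support_revWalk {u v z : M.Vert} {l : List D} (h : M.IsWalk u l v) :
    z ∈ M.support v (M.revWalk l) ↔ z ∈ M.support u l := by
  induction l generalizing u with
  | nil => cases isWalk_nil.1 h; simp [CombMap.revWalk]
  | cons d l ih =>
    rw [revWalk_cons, h.2.revWalk.mem_support_append, ih h.2]
    have := h.1
    simp only [support_cons, support_nil, head_rev, List.mem_cons, List.not_mem_nil, or_false, this]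
    constructor
    · rintro (h' | rfl | rfl)
      · exact Or.inr h'
      · exact Or.inr (start_mem_support _ _)
      · exact Or.inl rfl
    · rintro (rfl | h')
      · exact Or.inr (Or.inr rfl)
      · exact Or.inl h'

/-- A walk that starts in a set and ends outside of it leaves the set along one of its darts. -/
theorem IsWalk.exists_exit {u v : M.Vert} {l : List D} (h : M.IsWalk u l v) {S : Set M.Vert}
    (hu : u ∈ S) {w : M.Vert} (hw : w ∈ M.support u l) (hwS : w ∉ S) :
    ∃ A d B, l = A ++ d :: B ∧ M.IsWalk u A (M.tail d) ∧ M.IsWalk (M.head d) B v ∧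
      (∀ z ∈ M.support u A, z ∈ S) ∧ M.head d ∉ S := by
  induction l generalizing u with
  | nil => simp only [support_nil, List.mem_singleton] at hw; exact absurd (hw ▸ hu) hwS
  | cons d l ih =>
    by_cases hd : M.head d ∈ S
    · rcases List.mem_cons.1 hw with rfl | hw
      · exact absurd hu hwS
      · obtain ⟨A, e, B, rfl, hA, hB, hS, he⟩ := ih h.2 hd hw
        refine ⟨d :: A, e, B, rfl, ⟨h.1, hA⟩, hB, ?_, he⟩
        intro z hz
        rcases List.mem_cons.1 hz with rfl | hz
        · exact hu
        · exact hS z hz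
    · exact ⟨[], d, l, rfl, h.1.symm, h.2, by simpa using hu, hd⟩

/-- Loop erasure. -/
theorem IsWalk.exists_nodup {u v : M.Vert} {l : List D} (h : M.IsWalk u l v) :
    ∃ l', M.IsWalk u l' v ∧ (M.support u l').Nodup ∧ (∀ z ∈ M.support u l', z ∈ M.support u l) ∧
      l'.length ≤ l.length := by
  induction l generalizing u with
  | nil => exact ⟨[], h, by simp, fun _ h => h, le_rfl⟩
  | cons d l ih =>
    obtain ⟨l', hl', hn, hs, hlen⟩ := ih h.2
    by_cases hu : u ∈ M.support (M.head d) l'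
    · obtain ⟨A, B, rfl, hA, hB⟩ := hl'.split hu
      refine ⟨B, hB, ?_, fun z hz => List.mem_cons_of_mem _
        (hs z (hA.mem_support_append.2 (Or.inr hz))), ?_⟩
      · clear hs hlen ih h
        generalize M.head d = w at *
        induction A generalizing w with
        | nil => cases isWalk_nil.1 hA; exact hn
        | cons e A ih =>
          exact ih _ (hA.2.append hB) (List.nodup_cons.1 hn).2
            (hA.2.mem_support_append.2 (Or.inl hA.2.end_mem_support)) hA.2
      · simp at hlen ⊢; omega
    · refine ⟨d :: l', ⟨h.1, hl'⟩, List.nodup_cons.2 ⟨hu, hn⟩, ?_, by simpa using hlen⟩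
      intro z hz
      rcases List.mem_cons.1 hz with rfl | hz
      · exact start_mem_support _ _
      · exact List.mem_cons_of_mem _ (hs z hz)

/-! ### Shortest paths -/

theorem IsShortest.length_eq {u v : M.Vert} {l l' : List D} (h : M.IsShortest u l v)
    (h' : M.IsShortest u l' v) : l.length = l'.length :=
  le_antisymm (h.2 _ h'.1) (h'.2 _ h.1)

theorem IsShortest.of_length_le {u v : M.Vert} {l l' : List D} (h : M.IsShortest u l v)
    (h' : M.IsWalk u l' v) (hl : l'.length ≤ l.length) : M.IsShortest u l' v :=
  ⟨h', fun m hm => hl.trans (h.2 m hm)⟩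

theorem IsShortest.left {u v w : M.Vert} {A B : List D} (h : M.IsShortest u (A ++ B) v)
    (hA : M.IsWalk u A w) (hB : M.IsWalk w B v) : M.IsShortest u A w := by
  refine ⟨hA, fun m hm => ?_⟩
  have := h.2 _ (hm.append hB)
  simp only [List.length_append] at this
  omega

theorem IsShortest.right {u v w : M.Vert} {A B : List D} (h : M.IsShortest u (A ++ B) v)
    (hA : M.IsWalk u A w) (hB : M.IsWalk w B v) : M.IsShortest w B v := by
  refine ⟨hB, fun m hm => ?_⟩
  have := h.2 _ (hA.append hm)
  simp only [List.length_append] at this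
  omega

theorem IsShortest.revWalk {u v : M.Vert} {l : List D} (h : M.IsShortest u l v) :
    M.IsShortest v (M.revWalk l) u := by
  refine ⟨h.1.revWalk, fun m hm => ?_⟩
  have := h.2 _ hm.revWalk
  simpa using this

theorem IsShortest.nodup_support {u v : M.Vert} {l : List D} (h : M.IsShortest u l v) :
    (M.support u l).Nodup := by
  induction l generalizing u with
  | nil => simp
  | cons d l ih =>
    have h1 : M.IsWalk u [d] (M.head d) := isWalk_singleton.2 ⟨h.1.1, rfl⟩
    refine List.nodup_cons.2 ⟨fun hu => ?_, ih (IsShortest.right (A := [d]) h h1 h.1.2)⟩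
    obtain ⟨A, B, rfl, -, hB⟩ := h.1.2.split hu
    have := h.2 B hB
    simp at this

theorem IsWalk.rev_notMem {u v : M.Vert} {l : List D} (h : M.IsWalk u l v)
    (hn : (M.support u l).Nodup) {d : D} (hd : d ∈ l) : M.rev d ∉ l := by
  induction l generalizing u with
  | nil => simp at hd
  | cons e l ih =>
    obtain ⟨hu, hn⟩ := List.nodup_cons.1 hn
    intro hr
    rcases List.mem_cons.1 hd with rfl | hd
    · rcases List.mem_cons.1 hr with hr | hr
      · exact M.rev_ne _ hr
      · exact hu ((head_rev d).trans h.1 ▸ head_mem_support (u := M.head d) hr)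
    · rcases List.mem_cons.1 hr with hr | hr
      · refine hu ?_
        have := head_mem_support (M := M) (u := M.head e) hd
        rwa [show u = M.head d by rw [← h.1, ← hr, tail_rev]]
      · exact ih h.2 hn hd hr

end CombMap

/-! ### Arcs of a cycle -/

namespace CombMap

variable {D : Type*} {ρ : Equiv.Perm D}

theorem exists_period [Finite D] (ρ : Equiv.Perm D) (b : D) :
    ∃ T, 0 < T ∧ (ρ ^ T) b = b ∧ ∀ m, 0 < m → m < T → (ρ ^ m) b ≠ b := by
  classical
  have h : ∃ T, 0 < T ∧ (ρ ^ T) b = b := ⟨orderOf ρ, orderOf_pos ρ, by simp [pow_orderOf_eq_one]⟩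
  exact ⟨Nat.find h, (Nat.find_spec h).1, (Nat.find_spec h).2,
    fun m hm hlt he => Nat.find_min h hlt ⟨hm, he⟩⟩

theorem pow_sub_apply_eq {b : D} {m n : ℕ} (hmn : m ≤ n) (h : (ρ ^ m) b = (ρ ^ n) b) :
    (ρ ^ (n - m)) b = b := by
  obtain ⟨k, rfl⟩ := Nat.exists_eq_add_of_le hmn
  rw [pow_add, Equiv.Perm.mul_apply] at h
  rw [Nat.add_sub_cancel_left]
  exact ((ρ ^ m).injective h).symm

theorem pow_apply_injOn {b : D} {T : ℕ} (hT : ∀ m, 0 < m → m < T → (ρ ^ m) b ≠ b) {m n : ℕ}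
    (hm : 0 < m) (hn : 0 < n) (hmT : m ≤ T) (hnT : n ≤ T) (h : (ρ ^ m) b = (ρ ^ n) b) : m = n := by
  rcases lt_trichotomy m n with hlt | rfl | hlt
  · exact absurd (pow_sub_apply_eq hlt.le h) (hT _ (by omega) (by omega))
  · rfl
  · exact absurd (pow_sub_apply_eq hlt.le h.symm) (hT _ (by omega) (by omega))

/-- Exponents run from 1 to T instead of from 0 to T - 1: thus b itself gets the exponent T, in
agreement with the convention that the arc from b to b is a full turn. -/
theorem exists_pos_of_sameCycle [Finite D] {b d : D} {T : ℕ} (hT0 : 0 < T) (hTb : (ρ ^ T) b = b)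
    (h : ρ.SameCycle b d) : ∃ m, 0 < m ∧ m ≤ T ∧ (ρ ^ m) b = d := by
  obtain ⟨n, hn⟩ := h.exists_nat_pow_eq
  have hk : ∀ k, (ρ ^ (T * k)) b = b := by
    intro k
    induction k with
    | zero => simp
    | succ k ih => rw [Nat.mul_succ, pow_add, Equiv.Perm.mul_apply, hTb, ih]
  have hmod : (ρ ^ (n % T)) b = d := by
    rw [← hn]
    conv_rhs => rw [← Nat.mod_add_div n T, pow_add, Equiv.Perm.mul_apply, hk]
  rcases Nat.eq_zero_or_pos (n % T) with h0 | h0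
  · exact ⟨T, hT0, le_rfl, by rw [hTb, ← hmod, h0]; simp⟩
  · exact ⟨n % T, h0, (Nat.mod_lt _ hT0).le, hmod⟩

theorem mem_arc_pow {b d : D} {N : ℕ} (hN0 : 0 < N) (hN : ∀ m, 0 < m → m < N → (ρ ^ m) b ≠ b) :
    d ∈ arc ρ b ((ρ ^ N) b) ↔ ∃ m, 0 < m ∧ m < N ∧ d = (ρ ^ m) b := by
  constructor
  · rintro ⟨-, n, rfl, hn⟩
    refine ⟨n + 1, by omega, ?_, rfl⟩
    by_contra hlt
    exact hn (N - 1) (by omega) (by rw [Nat.sub_add_cancel hN0])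
  · rintro ⟨m, hm, hmN, rfl⟩
    refine ⟨hN m hm hmN, m - 1, by rw [Nat.sub_add_cancel hm], fun k hk he => ?_⟩
    have := pow_apply_injOn hN (by omega) hN0 (by omega) le_rfl he
    omega

/-- Backward arcs are expressed by the same powers of ρ from the same base dart as forward arcs, so
that the two sides of a path can be compared as intervals of exponents. -/
theorem mem_arc_inv_pow {b d : D} {T u v : ℕ} (hT : ∀ m, 0 < m → m < T → (ρ ^ m) b ≠ b)
    (huv : u < v) (hv : v ≤ u + T) :
    d ∈ arc ρ⁻¹ ((ρ ^ v) b) ((ρ ^ u) b) ↔ ∃ m, u < m ∧ m < v ∧ d = (ρ ^ m) b := by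
  have key : ∀ m, m ≤ v → ((ρ⁻¹) ^ m) ((ρ ^ v) b) = (ρ ^ (v - m)) b := by
    intro m hm
    obtain ⟨k, rfl⟩ := Nat.exists_eq_add_of_le hm
    rw [Nat.add_sub_cancel_left, pow_add, Equiv.Perm.mul_apply, inv_pow, Equiv.Perm.inv_def, Equiv.symm_apply_apply]
  have hu : (ρ ^ u) b = ((ρ⁻¹) ^ (v - u)) ((ρ ^ v) b) := by
    rw [key _ (by omega)]; congr 2; omega
  rw [hu, mem_arc_pow (by omega)]
  · constructor
    · rintro ⟨m, h0, hm, rfl⟩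
      exact ⟨v - m, by omega, by omega, key _ (by omega)⟩
    · rintro ⟨m, h0, hm, rfl⟩
      exact ⟨v - m, by omega, by omega, by rw [key _ (by omega)]; congr 2; omega⟩
  · intro m h0 hm he
    rw [key m (by omega)] at he
    have := pow_sub_apply_eq (by omega) he
    exact hT m h0 (by omega) (by rwa [show v - (v - m) = m by omega] at this)

theorem self_notMem_arc {b o : D} : b ∉ arc ρ b o := fun h => h.1 rfl

theorem end_notMem_arc {b o : D} : o ∉ arc ρ b o := by
  rintro ⟨-, n, h, hn⟩
  exact hn n le_rfl h.symm

theorem sameCycle_of_mem_arc {b o d : D} (h : d ∈ arc ρ b o) : ρ.SameCycle b d := by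
  obtain ⟨-, n, rfl, -⟩ := h
  exact ⟨(n + 1 : ℕ), by simp only [zpow_natCast]⟩

/-- The half-open arc from `b` to `o` is moved by `ρ` to the arc that is closed on the other end. -/
theorem apply_mem_arc_or_eq [Finite D] {b o d : D} (h : ρ.SameCycle b o) :
    ρ d ∈ arc ρ b o ∨ ρ d = o ↔ d = b ∨ d ∈ arc ρ b o := by
  obtain ⟨T, hT0, hTb, hT⟩ := exists_period ρ b
  obtain ⟨N, hN0, hNT, rfl⟩ := exists_pos_of_sameCycle hT0 hTb h
  rw [mem_arc_pow hN0 fun m h0 hm => hT m h0 (by omega),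
    mem_arc_pow hN0 fun m h0 hm => hT m h0 (by omega)]
  have succ : ∀ m, ρ ((ρ ^ m) b) = (ρ ^ (m + 1)) b := fun m => by
    rw [pow_succ', Equiv.Perm.mul_apply]
  constructor
  · have : ∀ m, 0 < m → m ≤ N → ρ d = (ρ ^ m) b → d = b ∨ ∃ m, 0 < m ∧ m < N ∧ d = (ρ ^ m) b := by
      intro m h0 hm he
      obtain ⟨k, rfl⟩ : ∃ k, m = k + 1 := ⟨m - 1, by omega⟩
      rw [← succ] at he
      have he := ρ.injective he
      rcases Nat.eq_zero_or_pos k with rfl | hk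
      · exact Or.inl he
      · exact Or.inr ⟨k, hk, by omega, he⟩
    rintro (⟨m, h0, hm, he⟩ | he)
    · exact this m h0 hm.le he
    · exact this N hN0 le_rfl he
  · have : ∀ m, m < N → d = (ρ ^ m) b → (∃ m, 0 < m ∧ m < N ∧ ρ d = (ρ ^ m) b) ∨
        ρ d = (ρ ^ N) b := by
      rintro m hm rfl
      rw [succ]
      rcases (by omega : m + 1 < N ∨ m + 1 = N) with h | rfl
      · exact Or.inl ⟨m + 1, by omega, h, rfl⟩
      · exact Or.inr rfl
    rintro (he | ⟨m, h0, hm, he⟩)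
    · exact this 0 hN0 he
    · exact this m hm he

/-- The pairs of darts that bound the two sides of a path at one of its vertices, where `Q` holds the
darts of the edges of the path. The scan on the second side starts at the same dart as the scan on
the first side, or one step later at the first vertex of the path; it ends at the same dart, or one
step earlier at the last vertex. -/
def OppositePair (ρ : Equiv.Perm D) (Q : Set D) (q q' : D × D) : Prop :=
  (q'.1 = q.1 ∧ q'.2 = q.2 ∧ q.1 ≠ q.2 ∧ q.1 ∈ Q ∧ q.2 ∈ Q) ∨
    (q'.1 = ρ q.1 ∧ q'.2 = q.2 ∧ q.2 ∈ Q) ∨ (q'.1 = q.1 ∧ q.2 = ρ q'.2 ∧ q.1 ∈ Q) ∨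
    (q'.1 = ρ q.1 ∧ q.2 = ρ q'.2 ∧ q.1 ≠ q'.2)

/-- In exponents 1, …, T counted from `q.1`, the first arc is the interval below N. The second is
the interval above N or N - 1 and below T or T + 1, according to whether its ends are shifted by one
step. What is left over are darts of the path. -/
theorem OppositePair.partition [Finite D] {Q : Set D} {q q' : D × D}
    (hq : OppositePair ρ Q q q') (h : ρ.SameCycle q.1 q.2) {d : D} (hd : ρ.SameCycle q.1 d) :
    ¬(d ∈ arc ρ q.1 q.2 ∧ d ∈ arc ρ⁻¹ q'.1 q'.2) ∧
      (d ∈ arc ρ q.1 q.2 ∨ d ∈ arc ρ⁻¹ q'.1 q'.2 ∨ d ∈ Q) := by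
  obtain ⟨b, o⟩ := q
  obtain ⟨b', o'⟩ := q'
  simp only [OppositePair] at *
  obtain ⟨T, hT0, hTb, hT⟩ := exists_period ρ b
  obtain ⟨N, hN0, hNT, rfl⟩ := exists_pos_of_sameCycle hT0 hTb h
  obtain ⟨m, hm0, hmT, rfl⟩ := exists_pos_of_sameCycle hT0 hTb hd
  have succ : ∀ m, (ρ ^ (m + 1)) b = ρ ((ρ ^ m) b) := fun m => by
    rw [pow_succ', Equiv.Perm.mul_apply]
  have hL : (ρ ^ m) b ∈ arc ρ b ((ρ ^ N) b) ↔ m < N := by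
    rw [mem_arc_pow hN0 fun m h0 hm => hT m h0 (by omega)]
    constructor
    · rintro ⟨k, hk0, hk, he⟩
      rwa [pow_apply_injOn hT hm0 hk0 hmT (by omega) he]
    · exact fun h => ⟨m, hm0, h, rfl⟩
  have hR : ∀ u v, u < v → v ≤ u + T → v ≤ T + 1 →
      ((ρ ^ m) b ∈ arc ρ⁻¹ ((ρ ^ v) b) ((ρ ^ u) b) ↔ u < m ∧ m < v) := by
    intro u v huv hv hv'
    rw [mem_arc_inv_pow hT huv hv]
    constructor
    · rintro ⟨k, hk0, hk, he⟩
      rw [pow_apply_injOn hT hm0 (by omega) hmT (by omega) he]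
      exact ⟨hk0, hk⟩
    · exact fun h => ⟨m, h.1, h.2, rfl⟩
  have hTb' : (ρ ^ (T + 1)) b = ρ b := by rw [succ, hTb]
  have pred : ∀ o', (ρ ^ N) b = ρ o' → o' = (ρ ^ (N - 1)) b := by
    intro o' ho
    obtain ⟨k, rfl⟩ : ∃ k, N = k + 1 := ⟨N - 1, by omega⟩
    rw [succ] at ho
    exact (ρ.injective ho).symm
  rw [hL]
  rcases hq with ⟨rfl, rfl, hne, hb, ho⟩ | ⟨rfl, rfl, ho⟩ | ⟨rfl, ho, hb⟩ | ⟨rfl, ho, hne⟩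
  · have hlt : N < T := lt_of_le_of_ne hNT fun h => hne (by rw [h, hTb])
    have := hR N T hlt (by omega) (by omega)
    rw [hTb] at this
    rw [this]
    refine ⟨by omega, ?_⟩
    rcases (by omega : m < N ∨ (N < m ∧ m < T) ∨ m = N ∨ m = T) with h | h | rfl | rfl
    · exact Or.inl h
    · exact Or.inr (Or.inl h)
    · exact Or.inr (Or.inr ho)
    · exact Or.inr (Or.inr (hTb.symm ▸ hb))
  · have := hR N (T + 1) (by omega) (by omega) le_rfl
    rw [hTb'] at this
    rw [this]
    refine ⟨by omega, ?_⟩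
    rcases (by omega : m < N ∨ (N < m ∧ m < T + 1) ∨ m = N) with h | h | rfl
    · exact Or.inl h
    · exact Or.inr (Or.inl h)
    · exact Or.inr (Or.inr ho)
  · obtain rfl := pred _ ho
    have := hR (N - 1) T (by omega) (by omega) (by omega)
    rw [hTb] at this
    rw [this]
    refine ⟨by omega, ?_⟩
    rcases (by omega : m < N ∨ (N - 1 < m ∧ m < T) ∨ m = T) with h | h | rfl
    · exact Or.inl h
    · exact Or.inr (Or.inl h)
    · exact Or.inr (Or.inr (hTb.symm ▸ hb))
  · obtain rfl := pred _ ho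
    -- With N = 1 both ends of the cut would be the same corner, and the second scan, from exponent
    -- T + 1 down to 0, would exceed a full turn.
    have hN1 : N ≠ 1 := by rintro rfl; exact hne (by simp)
    have := hR (N - 1) (T + 1) (by omega) (by omega) le_rfl
    rw [hTb'] at this
    rw [this]
    exact ⟨by omega, by omega⟩

end CombMap

/-! ### Potentials on plane maps -/

namespace CombMap

variable {D : Type*} {M : CombMap D}

theorem apply_eq_of_sameCycle {α : Type*} {ρ : Equiv.Perm D} {φ : D → α}
    (h : ∀ d, φ (ρ d) = φ d) {a b : D} (hab : ρ.SameCycle a b) : φ a = φ b := by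
  obtain ⟨n, rfl⟩ := hab
  have hinv : ∀ d, φ (ρ⁻¹ d) = φ d := fun d => by
    conv_rhs => rw [← Equiv.apply_symm_apply ρ d, h]
    rfl
  induction n with
  | zero => simp
  | succ n ih => rw [add_comm, zpow_one_add, Equiv.Perm.mul_apply, h, ih]
  | pred n ih =>
    rw [show (-(n : ℤ) - 1) = -1 + -n by ring, zpow_add, zpow_neg_one, Equiv.Perm.mul_apply, hinv,
      ih]

theorem Connected.apply_eq {α : Type*} (hM : M.Connected) {φ : D → α}
    (hrot : ∀ d, φ (M.rot d) = φ d) (hrev : ∀ d, φ (M.rev d) = φ d) (a b : D) : φ a = φ b := by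
  obtain ⟨l, hl⟩ := hM (M.tail a) (M.tail b)
  generalize hu : M.tail a = u at hl
  induction l generalizing a u with
  | nil => exact apply_eq_of_sameCycle hrot (tail_eq_tail.1 (hu.trans (isWalk_nil.1 hl)))
  | cons d l ih =>
    rw [apply_eq_of_sameCycle hrot (tail_eq_tail.1 (hu.trans hl.1.symm)), ← hrev d]
    exact ih _ _ rfl hl.2

instance [Finite D] : Finite M.Vert := Quotient.finite _
instance [Finite D] : Finite M.Edge := Quotient.finite _
instance [Finite D] : Finite M.Face := Quotient.finite _

/-- The edge of a dart. -/
def edgeOf (M : CombMap D) (d : D) : M.Edge := Quotient.mk _ d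

/-- The face on the left of a dart. -/
def faceOf (M : CombMap D) (d : D) : M.Face := Quotient.mk _ d

theorem edgeOf_rev (d : D) : M.edgeOf (M.rev d) = M.edgeOf d :=
  Quotient.sound (Equiv.Perm.sameCycle_apply_left.2 (Equiv.Perm.SameCycle.refl _ _))

theorem faceOf_face (d : D) : M.faceOf (M.face d) = M.faceOf d :=
  Quotient.sound (Equiv.Perm.sameCycle_apply_left.2 (Equiv.Perm.SameCycle.refl _ _))

theorem faceOf_eq_faceOf {d e : D} : M.faceOf d = M.faceOf e ↔ M.face.SameCycle d e :=
  ⟨fun h => Quotient.exact h, fun h => Quotient.sound h⟩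

theorem edgeOf_eq_edgeOf {d e : D} : M.edgeOf d = M.edgeOf e ↔ d = e ∨ d = M.rev e := by
  constructor
  · intro h
    have h : M.rev.SameCycle d e := Quotient.exact h
    have := apply_eq_of_sameCycle (ρ := M.rev) (φ := fun d => ({d, M.rev d} : Set D))
      (fun d => by rw [M.rev_rev, Set.pair_comm]) h
    have hd : d ∈ ({e, M.rev e} : Set D) := this ▸ Set.mem_insert _ _
    simpa using hd
  · rintro (rfl | rfl)
    · rfl
    · exact edgeOf_rev e

theorem two_mul_card_edge [Finite D] (M : CombMap D) : 2 * Nat.card M.Edge = Nat.card D := by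
  classical
  have := Fintype.ofFinite D
  have := Fintype.ofFinite M.Edge
  rw [Nat.card_eq_fintype_card, Nat.card_eq_fintype_card, ← Finset.card_univ (α := D),
    Finset.card_eq_sum_card_fiberwise (f := M.edgeOf) (t := Finset.univ) (fun _ _ => by simp)]
  rw [Finset.sum_const_nat (m := 2), Finset.card_univ, mul_comm]
  intro e _
  obtain ⟨d, rfl⟩ : ∃ d, M.edgeOf d = e := Quotient.exists_rep e
  rw [show (Finset.univ.filter fun x => M.edgeOf x = M.edgeOf d) = {d, M.rev d} by
    ext x; simp [edgeOf_eq_edgeOf]]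
  exact Finset.card_pair (M.rev_ne d).symm

/-! ### Orthogonality of coboundaries and boundaries -/

section Potential

variable [Fintype D]

theorem sum_mul_sub_rev {a s : D → ℚ} (ha : ∀ d, a (M.rev d) = -a d) :
    ∑ d, a d * (s d - s (M.rev d)) = 2 * ∑ d, a d * s d := by
  have h := Equiv.sum_comp M.rev fun d => a d * s (M.rev d)
  simp only [ha, M.rev_rev, neg_mul, Finset.sum_neg_distrib] at h
  simp only [mul_sub, Finset.sum_sub_distrib]
  linarith

/-- The boundary of a face is a closed walk, so the differences of f telescope along it. -/
theorem sum_coboundary_mul {f : M.Vert → ℚ} {g : D → ℚ} (hg : ∀ d, g (M.face d) = g d) :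
    ∑ d, (f (M.head d) - f (M.tail d)) * g d = 0 := by
  have h := Equiv.sum_comp M.face fun d => f (M.tail d) * g d
  simp only [hg, tail_face] at h
  simp only [sub_mul, Finset.sum_sub_distrib, h, sub_self]

theorem eq_zero_of_sum_mul_self {a : D → ℚ} (h : ∑ d, a d * a d = 0) (d : D) : a d = 0 := by
  rw [Finset.sum_eq_zero_iff_of_nonneg fun d _ => mul_self_nonneg (a d)] at h
  exact mul_self_eq_zero.1 (h d (Finset.mem_univ d))

/-- The sum of the coboundary of a function of the vertices, the boundary of a function of the faces
and a function of the edges. -/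
def cochain (M : CombMap D) :
    ((M.Vert → ℚ) × (M.Face → ℚ) × (M.Edge → ℚ)) →ₗ[ℚ] (D → ℚ) where
  toFun x d := (x.1 (M.head d) - x.1 (M.tail d)) +
    (x.2.1 (M.faceOf d) - x.2.1 (M.faceOf (M.rev d))) + x.2.2 (M.edgeOf d)
  map_add' x y := by ext d; simp; ring
  map_smul' c x := by ext d; simp; ring

theorem cochain_orthogonal (f : M.Vert → ℚ) (g : M.Face → ℚ) :
    ∑ d, (f (M.head d) - f (M.tail d)) * (g (M.faceOf d) - g (M.faceOf (M.rev d))) = 0 := by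
  rw [sum_mul_sub_rev (M := M) (s := fun d => g (M.faceOf d)),
    sum_coboundary_mul fun d => by rw [faceOf_face], mul_zero]
  intro d
  rw [head_rev, tail_rev]
  ring

/-- The edge part is symmetric under reversal and the other two parts are antisymmetric, so it
vanishes by itself. The coboundary is then minus the boundary, hence orthogonal to itself. -/
theorem cochain_eq_zero {f : M.Vert → ℚ} {g : M.Face → ℚ} {e : M.Edge → ℚ}
    (h : M.cochain (f, g, e) = 0) :
    (∀ d, f (M.head d) = f (M.tail d)) ∧ (∀ d, g (M.faceOf (M.rev d)) = g (M.faceOf d)) ∧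
      e = 0 := by
  have hd : ∀ d, (f (M.head d) - f (M.tail d)) + (g (M.faceOf d) - g (M.faceOf (M.rev d))) +
    e (M.edgeOf d) = 0 := fun d => congrFun h d
  have he : ∀ d, e (M.edgeOf d) = 0 := by
    intro d
    have := hd d
    have h2 := hd (M.rev d)
    rw [edgeOf_rev, head_rev, tail_rev, M.rev_rev] at h2
    linarith
  have hf : ∀ d, f (M.head d) - f (M.tail d) = 0 := by
    refine eq_zero_of_sum_mul_self (a := fun d => f (M.head d) - f (M.tail d)) ?_
    rw [← cochain_orthogonal (M := M) f (-g)]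
    refine Finset.sum_congr rfl fun d _ => ?_
    have := hd d
    rw [he] at this
    congr 1
    simp only [Pi.neg_apply]
    linarith
  refine ⟨fun d => by linarith [hf d], fun d => by linarith [hf d, hd d, he d], ?_⟩
  ext x
  obtain ⟨d, rfl⟩ : ∃ d, M.edgeOf d = x := Quotient.exists_rep x
  exact he d

/-- A dimension count. On the kernel, f and g are constant by connectivity and e is zero, so the
kernel has dimension at most 2; the source has dimension V + F + E ≥ 2E + 2, and the target has
dimension 2E. -/
theorem cochain_surjective [Nonempty D] (hM : M.Connected)
    (hE : Nat.card M.Edge + 2 ≤ Nat.card M.Vert + Nat.card M.Face) :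
    Function.Surjective M.cochain := by
  classical
  have := Fintype.ofFinite M.Vert
  have := Fintype.ofFinite M.Edge
  have := Fintype.ofFinite M.Face
  obtain ⟨d₀⟩ := ‹Nonempty D›
  have hker : Module.finrank ℚ (LinearMap.ker M.cochain) ≤ 2 := by
    let ev : ((M.Vert → ℚ) × (M.Face → ℚ) × (M.Edge → ℚ)) →ₗ[ℚ] ℚ × ℚ :=
      { toFun := fun x => (x.1 (M.tail d₀), x.2.1 (M.faceOf d₀))
        map_add' := fun x y => rfl
        map_smul' := fun c x => rfl }
    have hinj : Function.Injective (ev.comp (LinearMap.ker M.cochain).subtype) := by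
      rw [injective_iff_map_eq_zero]
      rintro ⟨⟨f, g, e⟩, hx⟩ h0
      obtain ⟨hf, hg, rfl⟩ := cochain_eq_zero (LinearMap.mem_ker.1 hx)
      have h1 : f (M.tail d₀) = 0 := congrArg Prod.fst h0
      have h2 : g (M.faceOf d₀) = 0 := congrArg Prod.snd h0
      have h3 : f = 0 := by
        ext v
        obtain ⟨d, rfl⟩ := tail_surjective v
        exact (hM.apply_eq (φ := fun d => f (M.tail d)) (fun d => by rw [tail_rot])
          (fun d => hf d) d d₀).trans h1
      have h4 : g = 0 := by
        ext v
        obtain ⟨d, rfl⟩ : ∃ d, M.faceOf d = v := Quotient.exists_rep v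
        refine (hM.apply_eq (φ := fun d => g (M.faceOf d)) (fun d => ?_) hg d d₀).trans h2
        rw [← hg (M.rot d), ← faceOf_face (M.rev (M.rot d)), face]
        simp [M.rev_rev]
      simp [h3, h4]
    simpa using LinearMap.finrank_le_finrank_of_injective hinj
  have hrn := LinearMap.finrank_range_add_finrank_ker M.cochain
  have hle := Submodule.finrank_le (LinearMap.range M.cochain)
  have h2 := two_mul_card_edge M
  simp only [Nat.card_eq_fintype_card] at hE h2
  simp only [Module.finrank_prod, Module.finrank_fintype_fun_eq_card] at hrn hle
  rw [← LinearMap.range_eq_top]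
  apply Submodule.eq_top_of_finrank_eq
  rw [Module.finrank_fintype_fun_eq_card]
  omega

/-- On a plane map, an antisymmetric function of the darts whose sum along every face vanishes is the
coboundary of a function of the vertices. -/
theorem exists_potential (hM : M.Connected)
    (hE : Nat.card M.Edge + 2 ≤ Nat.card M.Vert + Nat.card M.Face) {ψ : D → ℚ}
    (hψ : ∀ d, ψ (M.rev d) = -ψ d)
    (hface : ∀ g : D → ℚ, (∀ d, g (M.face d) = g d) → ∑ d, ψ d * g d = 0) :
    ∃ f : M.Vert → ℚ, ∀ d, f (M.head d) - f (M.tail d) = ψ d := by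
  rcases isEmpty_or_nonempty D with hD | hD
  · exact ⟨fun _ => 0, fun d => hD.elim d⟩
  obtain ⟨⟨f, g, e⟩, hx⟩ := cochain_surjective hM hE ψ
  have hd : ∀ d, (f (M.head d) - f (M.tail d)) + (g (M.faceOf d) - g (M.faceOf (M.rev d))) +
    e (M.edgeOf d) = ψ d := fun d => congrFun hx d
  -- Both ψ and the first two parts are antisymmetric, so averaging over a dart and its reverse
  -- isolates the edge part.
  have he : ∀ d, e (M.edgeOf d) = 0 := by
    intro d
    have := hd d
    have h2 := hd (M.rev d)
    rw [edgeOf_rev, head_rev, tail_rev, M.rev_rev, hψ] at h2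
    linarith
  refine ⟨f, fun d => ?_⟩
  -- The boundary part is orthogonal to ψ by `hface` and to the coboundary part, hence to itself.
  have hg : ∀ d, g (M.faceOf d) - g (M.faceOf (M.rev d)) = 0 := by
    refine eq_zero_of_sum_mul_self
      (a := fun d => g (M.faceOf d) - g (M.faceOf (M.rev d))) ?_
    have h1 := cochain_orthogonal (M := M) f g
    have h2 := sum_mul_sub_rev (M := M) (s := fun d => g (M.faceOf d)) hψ
    rw [hface (fun d => g (M.faceOf d)) fun d => by rw [faceOf_face], mul_zero] at h2
    rw [← sub_zero (0 : ℚ)]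
    nth_rewrite 1 [← h2]
    rw [← h1, ← Finset.sum_sub_distrib]
    refine Finset.sum_congr rfl fun d _ => ?_
    rw [← hd, he]
    ring
  linarith [hd d, he d, hg d]

end Potential

end CombMap

/-! ### The two sides of a path -/

namespace CombMap

variable {D : Type*} {M : CombMap D}

/-- The pairs of darts that bound, at each vertex of the path `P`, one side of `P`. -/
def sidePairs (M : CombMap D) (r e : D) (P : List D) : List (D × D) :=
  List.zip (r :: P.map M.rev) (P ++ [e])

@[simp] theorem sidePairs_nil (r e : D) : M.sidePairs r e [] = [(r, e)] := rfl

@[simp] theorem sidePairs_cons (r e d : D) (P : List D) :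
    M.sidePairs r e (d :: P) = (r, d) :: M.sidePairs (M.rev d) e P := rfl

theorem map_tail_sidePairs (r e : D) (P : List D) :
    (M.sidePairs r e P).map (fun q => M.tail q.1) = M.support (M.tail r) P := by
  induction P generalizing r with
  | nil => rfl
  | cons d P ih => simp [ih, tail_rev]

theorem tail_eq_of_mem_sidePairs {r e : D} {P : List D} (h : M.IsWalk (M.tail r) P (M.tail e))
    {q : D × D} (hq : q ∈ M.sidePairs r e P) : M.tail q.1 = M.tail q.2 := by
  induction P generalizing r with
  | nil => obtain rfl := List.mem_singleton.1 hq; exact h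
  | cons d P ih =>
    rcases List.mem_cons.1 hq with rfl | hq
    · exact h.1.symm
    · exact ih h.2 hq

theorem tail_mem_support_of_mem_sidePairs {r e : D} {P : List D} {q : D × D}
    (hq : q ∈ M.sidePairs r e P) : M.tail q.1 ∈ M.support (M.tail r) P := by
  rw [← map_tail_sidePairs r e P]
  exact List.mem_map_of_mem (f := fun q : D × D => M.tail q.1) hq

theorem exists_mem_sidePairs {r : D} (e : D) {P : List D} {w : M.Vert}
    (hw : w ∈ M.support (M.tail r) P) : ∃ q ∈ M.sidePairs r e P, M.tail q.1 = w := by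
  rw [← map_tail_sidePairs r e P] at hw
  simpa using hw

theorem fst_mem_sidePairs (r e : D) (P : List D) : ∃ q ∈ M.sidePairs r e P, q.1 = r := by
  cases P <;> simp

theorem snd_mem_sidePairs (r e : D) (P : List D) : ∃ q ∈ M.sidePairs r e P, q.2 = e := by
  induction P generalizing r with
  | nil => simp
  | cons d P ih =>
    obtain ⟨q, hq, h⟩ := ih (M.rev d)
    exact ⟨q, List.mem_cons_of_mem _ hq, h⟩

theorem exists_snd_eq {r e d : D} {P : List D} (hd : d ∈ P) :
    ∃ q ∈ M.sidePairs r e P, q.2 = d := by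
  induction P generalizing r with
  | nil => simp at hd
  | cons d' P ih =>
    rcases List.mem_cons.1 hd with rfl | hd
    · exact ⟨(r, d), List.mem_cons_self, rfl⟩
    · obtain ⟨q, hq, h⟩ := ih (r := M.rev d') hd
      exact ⟨q, List.mem_cons_of_mem _ hq, h⟩

theorem exists_fst_eq_rev {r e d : D} {P : List D} (hd : d ∈ P) :
    ∃ q ∈ M.sidePairs r e P, q.1 = M.rev d := by
  induction P generalizing r with
  | nil => simp at hd
  | cons d' P ih =>
    rcases List.mem_cons.1 hd with rfl | hd
    · obtain ⟨q, hq, h⟩ := fst_mem_sidePairs (M := M) (M.rev d) e P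
      exact ⟨q, List.mem_cons_of_mem _ hq, h⟩
    · obtain ⟨q, hq, h⟩ := ih (r := M.rev d') hd
      exact ⟨q, List.mem_cons_of_mem _ hq, h⟩

theorem eq_of_mem_sidePairs {r e : D} {P : List D} (hn : (M.support (M.tail r) P).Nodup)
    {q q' : D × D} (hq : q ∈ M.sidePairs r e P) (hq' : q' ∈ M.sidePairs r e P)
    (h : M.tail q.1 = M.tail q'.1) : q = q' := by
  rw [← map_tail_sidePairs r e P] at hn
  exact List.inj_on_of_nodup_map hn hq hq' h

/-- On a simple path only one pair sits at a given vertex, so a sum of local contributions has a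
single term. -/
theorem sum_sidePairs {r e : D} {P : List D} (hn : (M.support (M.tail r) P).Nodup)
    {q : D × D} (hq : q ∈ M.sidePairs r e P) {F : D × D → ℚ}
    (hF : ∀ q', M.tail q'.1 ≠ M.tail q.1 → F q' = 0) :
    ((M.sidePairs r e P).map F).sum = F q := by
  rw [← map_tail_sidePairs r e P] at hn
  generalize M.sidePairs r e P = l at *
  induction l with
  | nil => simp at hq
  | cons a l ih =>
    simp only [List.map_cons, List.nodup_cons] at hn
    rcases List.mem_cons.1 hq with rfl | hq
    · have : (l.map F).sum = 0 := by
        refine List.sum_eq_zero fun x hx => ?_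
        obtain ⟨q', hq', rfl⟩ := List.mem_map.1 hx
        exact hF q' fun h => hn.1 (List.mem_map.2 ⟨q', hq', h⟩)
      simp [this]
    · rw [List.map_cons, List.sum_cons, ih hn.2 hq, hF a, zero_add]
      exact fun h => hn.1 (List.mem_map.2 ⟨q, hq, h.symm⟩)

theorem tail_mem_support_of_mem_sideDarts {ρ : Equiv.Perm D} (hρ : ∀ d, M.tail (ρ d) = M.tail d)
    {r e d : D} {P : List D} (hd : d ∈ M.sideDarts ρ r e P) :
    M.tail d ∈ M.support (M.tail r) P := by
  obtain ⟨q, hq, h⟩ := hd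
  rw [← apply_eq_of_sameCycle hρ (sameCycle_of_mem_arc h)]
  exact tail_mem_support_of_mem_sidePairs hq

theorem support_subset_side {ρ : Equiv.Perm D} {r e : D} {P : List D} {w : M.Vert}
    (hw : w ∈ M.support (M.tail r) P) : w ∈ M.side ρ r e P := Or.inl hw

theorem head_mem_side {ρ : Equiv.Perm D} {r e d : D} {P : List D}
    (hd : d ∈ M.sideDarts ρ r e P) : M.head d ∈ M.side ρ r e P := by
  by_cases h : M.head d ∈ M.support (M.tail r) P
  · exact Or.inl h
  · exact Or.inr ⟨d, hd, [], rfl, by simpa using h⟩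

/-- Away from the path, a side is closed under adjacency; it can only be left through the path. -/
theorem head_mem_side_of_tail_mem {ρ : Equiv.Perm D} {r e d : D} {P : List D}
    (hd : M.tail d ∈ M.side ρ r e P) (hdP : M.tail d ∉ M.support (M.tail r) P) :
    M.head d ∈ M.side ρ r e P := by
  by_cases h : M.head d ∈ M.support (M.tail r) P
  · exact Or.inl h
  · obtain hd | ⟨d', hd', l, hl, hlP⟩ := hd
    · exact absurd hd hdP
    · refine Or.inr ⟨d', hd', l ++ [d], hl.append (isWalk_singleton.2 ⟨rfl, rfl⟩), fun z hz => ?_⟩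
      rcases hl.mem_support_append.1 hz with hz | hz
      · exact hlP z hz
      · simp only [support_cons, support_nil, List.mem_cons, List.not_mem_nil, or_false] at hz
        rcases hz with rfl | rfl
        · exact hdP
        · exact h

theorem tail_mem_side_of_head_mem {ρ : Equiv.Perm D} {r e d : D} {P : List D}
    (hd : M.head d ∈ M.side ρ r e P) (hdP : M.head d ∉ M.support (M.tail r) P) :
    M.tail d ∈ M.side ρ r e P := by
  rw [← head_rev]
  exact head_mem_side_of_tail_mem hd hdP

/-- A walk between a side of a path and the complement of that side meets the path. -/
theorem IsWalk.exists_mem_support_of_side {ρ : Equiv.Perm D} {r e : D} {P l : List D}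
    {u v w : M.Vert} (h : M.IsWalk u l v) (hu : u ∈ M.side ρ r e P) (hw : w ∈ M.support u l)
    (hwS : w ∉ M.side ρ r e P) : ∃ z ∈ M.support u l, z ∈ M.support (M.tail r) P := by
  obtain ⟨A, d, B, rfl, hA, hB, hS, hd⟩ := h.exists_exit hu hw hwS
  refine ⟨M.tail d, hA.mem_support_append.2 (Or.inl hA.end_mem_support), ?_⟩
  by_contra hc
  exact hd (head_mem_side_of_tail_mem (hS _ hA.end_mem_support) hc)

/-! #### Opposite sides -/

/-- At an inner vertex both scans run between the same two darts of the path; they differ only at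
the two ends, by one step around the outer corner. The two darts at an inner vertex are distinct
because a simple path does not turn back. -/
theorem forall₂_oppositePair {E : D} {P : List D} {Q : Set D}
    (hQ : ∀ d ∈ P, d ∈ Q ∧ M.rev d ∈ Q) {r r' : D}
    (hP : M.IsWalk (M.tail r) P (M.tail E)) (hn : (M.support (M.tail r) P).Nodup)
    (hr : (r' = M.rot r ∧ (P = [] → r ≠ E)) ∨ (r' = r ∧ r ∈ Q ∧ ∀ d ∈ P.head?, r ≠ d)) :
    List.Forall₂ (OppositePair M.rot Q) (M.sidePairs r (M.rot E) P) (M.sidePairs r' E P) := by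
  induction P generalizing r r' with
  | nil =>
    refine List.Forall₂.cons ?_ List.Forall₂.nil
    rcases hr with ⟨rfl, h⟩ | ⟨rfl, h, -⟩
    · exact Or.inr (Or.inr (Or.inr ⟨rfl, rfl, h rfl⟩))
    · exact Or.inr (Or.inr (Or.inl ⟨rfl, rfl, h⟩))
  | cons d P ih =>
    obtain ⟨hd, hd'⟩ := hQ d List.mem_cons_self
    refine List.Forall₂.cons ?_ (ih (fun d h => hQ d (List.mem_cons_of_mem _ h)) hP.2
      (List.nodup_cons.1 hn).2 (Or.inr ⟨rfl, hd', ?_⟩))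
    · rcases hr with ⟨rfl, h⟩ | ⟨rfl, h, h'⟩
      · exact Or.inr (Or.inl ⟨rfl, rfl, hd⟩)
      · exact Or.inl ⟨rfl, rfl, h' d rfl, h, hd⟩
    · rintro e he rfl
      have heP : M.rev d ∈ P := List.mem_of_mem_head? he
      exact hP.rev_notMem hn List.mem_cons_self (List.mem_cons_of_mem _ heP)

theorem forall₂_exists_left {α β : Type*} {R : α → β → Prop} {l : List α} {l' : List β}
    (h : List.Forall₂ R l l') {b : β} (hb : b ∈ l') : ∃ a ∈ l, R a b := by
  induction h with
  | nil => simp at hb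
  | cons hR _ ih =>
    rcases List.mem_cons.1 hb with rfl | hb
    · exact ⟨_, List.mem_cons_self, hR⟩
    · obtain ⟨a, ha, h⟩ := ih hb
      exact ⟨a, List.mem_cons_of_mem _ ha, h⟩

section Opposite

variable [Finite D] {L E : D} {P : List D}

theorem mem_sideDarts_or (hLE : L ≠ E) (hP : M.IsWalk (M.tail L) P (M.tail E))
    (hn : (M.support (M.tail L) P).Nodup) {d : D} (hd : M.tail d ∈ M.support (M.tail L) P)
    (hdP : d ∉ P) (hrd : M.rev d ∉ P) :
    d ∈ M.sideDarts M.rot L (M.rot E) P ∨ d ∈ M.sideDarts M.rot⁻¹ (M.rot L) E P := by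
  have hF := forall₂_oppositePair (Q := {d | d ∈ P ∨ M.rev d ∈ P}) (r' := M.rot L)
    (fun d hd => ⟨Or.inl hd, Or.inr (by rwa [M.rev_rev])⟩) hP hn (Or.inl ⟨rfl, fun _ => hLE⟩)
  obtain ⟨q, hq, hqd⟩ := exists_mem_sidePairs (M.rot E) hd
  obtain ⟨q', hq', hop⟩ := forall₂_exists_left hF.flip hq
  have hsame := tail_eq_of_mem_sidePairs (e := M.rot E) (by rwa [tail_rot]) hq
  rcases (OppositePair.partition hop (tail_eq_tail.1 hsame) (tail_eq_tail.1 hqd)).2 with h | h | h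
  · exact Or.inl ⟨q, hq, h⟩
  · exact Or.inr ⟨q', hq', h⟩
  · exact absurd h (by simp [hdP, hrd])

theorem notMem_sideDarts_of_mem (hLE : L ≠ E) (hP : M.IsWalk (M.tail L) P (M.tail E))
    (hn : (M.support (M.tail L) P).Nodup) {d : D}
    (hd : d ∈ M.sideDarts M.rot⁻¹ (M.rot L) E P) : d ∉ M.sideDarts M.rot L (M.rot E) P := by
  have hF := forall₂_oppositePair (Q := {d | d ∈ P ∨ M.rev d ∈ P}) (r' := M.rot L)
    (fun d hd => ⟨Or.inl hd, Or.inr (by rwa [M.rev_rev])⟩) hP hn (Or.inl ⟨rfl, fun _ => hLE⟩)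
  obtain ⟨q', hq', hd'⟩ := hd
  obtain ⟨q, hq, hop⟩ := forall₂_exists_left hF hq'
  rintro ⟨q₁, hq₁, hd₁⟩
  have hsame := tail_eq_of_mem_sidePairs (e := M.rot E) (by rwa [tail_rot]) hq
  have h1 := apply_eq_of_sameCycle (φ := M.tail) tail_rot (sameCycle_of_mem_arc hd₁)
  have h2 := apply_eq_of_sameCycle (φ := M.tail) tail_rot_inv (sameCycle_of_mem_arc hd')
  have h3 : M.tail q.1 = M.tail q'.1 := by
    rcases hop with h | h | h | h <;> simp [h.1, tail_rot]
  obtain rfl := eq_of_mem_sidePairs hn hq hq₁ (by rw [h1, h3, h2])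
  exact (OppositePair.partition hop (tail_eq_tail.1 hsame) (tail_eq_tail.1 h1)).1 ⟨hd₁, hd'⟩

/-- Only connectivity is needed here: a walk from the path can leave the union of the sides neither
off the path, where sides are closed under adjacency, nor at a vertex of the path, where every dart
off the path belongs to a side. That the sides do not overlap is where planarity enters. -/
theorem mem_side_or (hM : M.Connected) (hLE : L ≠ E) (hP : M.IsWalk (M.tail L) P (M.tail E))
    (hn : (M.support (M.tail L) P).Nodup) (w : M.Vert) :
    w ∈ M.side M.rot L (M.rot E) P ∨ w ∈ M.side M.rot⁻¹ (M.rot L) E P := by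
  by_contra hw
  obtain ⟨l, hl⟩ := hM (M.tail L) w
  obtain ⟨A, d, B, rfl, hA, hB, hS, hd⟩ := hl.exists_exit
    (S := M.side M.rot L (M.rot E) P ∪ M.side M.rot⁻¹ (M.rot L) E P)
    (Or.inl (Or.inl (start_mem_support _ _))) hl.end_mem_support hw
  have hsup : M.support (M.tail (M.rot L)) P = M.support (M.tail L) P := by rw [tail_rot]
  have hdP : M.head d ∉ M.support (M.tail L) P := fun h => hd (Or.inl (Or.inl h))
  have htd : M.tail d ∈ M.support (M.tail L) P := by
    by_contra hc
    rcases hS _ hA.end_mem_support with h | h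
    · exact hd (Or.inl (head_mem_side_of_tail_mem h hc))
    · exact hd (Or.inr (head_mem_side_of_tail_mem h (hsup ▸ hc)))
  rcases mem_sideDarts_or hLE hP hn htd (fun h => hdP (head_mem_support h))
    (fun h => hdP (hP.tail_mem_support h)) with h | h
  · exact hd (Or.inl (head_mem_side h))
  · exact hd (Or.inr (head_mem_side h))

end Opposite

end CombMap

/-! ### Separation by a path between two vertices of a face -/

namespace CombMap

variable {D : Type*} {M : CombMap D}

open Classical in
/-- The number of times the dart `d` leaves the path `P` on the first side. -/
noncomputable def sideCount (M : CombMap D) (r e : D) (P : List D) (d : D) : ℚ :=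
  ((M.sidePairs r e P).map fun q => if d ∈ arc M.rot q.1 q.2 then 1 else 0).sum

open Classical in
/-- The number of times the corner after the dart `d` lies on the first side of the path `P`. -/
noncomputable def cornerCount (M : CombMap D) (r e : D) (P : List D) (d : D) : ℚ :=
  ((M.sidePairs r e P).map fun q => if d = q.1 ∨ d ∈ arc M.rot q.1 q.2 then 1 else 0).sum

section Count

variable {r e : D} {P : List D}

-- The local identity behind the potential. Turning by `rot` leads from `M.face d` to `M.rev d`, so
-- counting darts of an arc amounts to counting its corners, up to a correction at each end of the
-- arc.
open Classical in
theorem ite_mem_arc_sub [Finite D] {b o : D} (h : M.tail b = M.tail o) (d : D) :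
    (if d ∈ arc M.rot b o then (1 : ℚ) else 0) - (if M.rev d ∈ arc M.rot b o then 1 else 0) =
      (if d = b ∨ d ∈ arc M.rot b o then 1 else 0) -
        (if M.face d = b ∨ M.face d ∈ arc M.rot b o then 1 else 0) -
          (if d = b then 1 else 0) + (if M.rev d = o then 1 else 0) := by
  have hf : M.rot (M.face d) = M.rev d := by simp [face]
  have key := apply_mem_arc_or_eq (d := M.face d) (tail_eq_tail.1 h)
  rw [hf] at key
  rw [if_congr key.symm rfl rfl]
  have h1 : (if d = b ∨ d ∈ arc M.rot b o then (1 : ℚ) else 0) =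
      (if d = b then 1 else 0) + if d ∈ arc M.rot b o then 1 else 0 := by
    by_cases hd : d = b
    · subst hd; simp [self_notMem_arc]
    · simp [hd]
  have h2 : (if M.rev d ∈ arc M.rot b o ∨ M.rev d = o then (1 : ℚ) else 0) =
      (if M.rev d = o then 1 else 0) + if M.rev d ∈ arc M.rot b o then 1 else 0 := by
    by_cases hd : M.rev d = o
    · subst hd; simp [end_notMem_arc]
    · simp [hd]
  rw [h1, h2]
  ring

-- The corrections telescope along the path: the one for a forward dart a at the end of an arc
-- cancels the one for `M.rev a` at the start of the next. Only the two ends of the path survive.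
open Classical in
theorem sideCount_sub [Finite D] (h : M.IsWalk (M.tail r) P (M.tail e)) (d : D) :
    M.sideCount r e P d - M.sideCount r e P (M.rev d) =
      M.cornerCount r e P d - M.cornerCount r e P (M.face d) - (if d = r then 1 else 0) +
        (if M.rev d = e then 1 else 0) := by
  induction P generalizing r with
  | nil => simpa [sideCount, cornerCount] using ite_mem_arc_sub (isWalk_nil.1 h) d
  | cons a P ih =>
    have h1 := ite_mem_arc_sub (M := M) h.1.symm d
    have h2 := ih (r := M.rev a) h.2
    have h3 : (if M.rev d = a then (1 : ℚ) else 0) = if d = M.rev a then 1 else 0 :=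
      if_congr ⟨fun h => by rw [← h, M.rev_rev], fun h => by rw [h, M.rev_rev]⟩ rfl rfl
    simp only [sideCount, cornerCount, sidePairs_cons, List.map_cons, List.sum_cons] at h2 ⊢
    linarith

open Classical in
theorem sideCount_eq (hn : (M.support (M.tail r) P).Nodup) {q : D × D}
    (hq : q ∈ M.sidePairs r e P) {d : D} (hd : M.tail q.1 = M.tail d) :
    M.sideCount r e P d = if d ∈ arc M.rot q.1 q.2 then 1 else 0 := by
  refine sum_sidePairs hn hq (F := fun q => if d ∈ arc M.rot q.1 q.2 then 1 else 0) fun q' hq' =>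
    if_neg fun h => hq' ?_
  rw [hd]
  exact tail_eq_tail.2 (sameCycle_of_mem_arc h)

open Classical in
theorem cornerCount_eq (hn : (M.support (M.tail r) P).Nodup) {q : D × D}
    (hq : q ∈ M.sidePairs r e P) {d : D} (hd : M.tail q.1 = M.tail d) :
    M.cornerCount r e P d = if d = q.1 ∨ d ∈ arc M.rot q.1 q.2 then 1 else 0 := by
  refine sum_sidePairs hn hq (F := fun q => if d = q.1 ∨ d ∈ arc M.rot q.1 q.2 then 1 else 0)
    fun q' hq' => if_neg fun h => hq' ?_
  rw [hd]
  rcases h with rfl | h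
  · rfl
  · exact tail_eq_tail.2 (sameCycle_of_mem_arc h)

theorem sideCount_eq_zero {d : D} (hd : d ∉ M.sideDarts M.rot r e P) :
    M.sideCount r e P d = 0 := by
  refine List.sum_eq_zero fun x hx => ?_
  obtain ⟨q, hq, rfl⟩ := List.mem_map.1 hx
  exact if_neg fun h => hd ⟨q, hq, h⟩

theorem sideCount_eq_one (hn : (M.support (M.tail r) P).Nodup) {d : D}
    (hd : d ∈ M.sideDarts M.rot r e P) : M.sideCount r e P d = 1 := by
  obtain ⟨q, hq, h⟩ := hd
  rw [sideCount_eq hn hq (tail_eq_tail.2 (sameCycle_of_mem_arc h)), if_pos h]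

theorem cornerCount_eq_zero {d : D} (hd : M.tail d ∉ M.support (M.tail r) P) :
    M.cornerCount r e P d = 0 := by
  refine List.sum_eq_zero fun x hx => ?_
  obtain ⟨q, hq, rfl⟩ := List.mem_map.1 hx
  refine if_neg fun h => hd ?_
  have : M.tail q.1 = M.tail d := by
    rcases h with rfl | h
    · rfl
    · exact tail_eq_tail.2 (sameCycle_of_mem_arc h)
  exact this ▸ tail_mem_support_of_mem_sidePairs hq

theorem notMem_sideDarts_of_tail {d : D} (hd : M.tail d ∉ M.support (M.tail r) P) :
    d ∉ M.sideDarts M.rot r e P := fun h => hd (tail_mem_support_of_mem_sideDarts tail_rot h)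

theorem notMem_sideDarts_of_mem_path (hP : M.IsWalk (M.tail r) P (M.tail e))
    (hn : (M.support (M.tail r) P).Nodup) {d : D}
    (hd : d ∈ P) : d ∉ M.sideDarts M.rot r e P ∧ M.rev d ∉ M.sideDarts M.rot r e P := by
  constructor
  · rintro ⟨q, hq, h⟩
    obtain ⟨q', hq', rfl⟩ := exists_snd_eq (M := M) (r := r) (e := e) hd
    have h1 := tail_eq_tail.2 (sameCycle_of_mem_arc h)
    obtain rfl := eq_of_mem_sidePairs hn hq hq'
      (h1.trans (tail_eq_of_mem_sidePairs hP hq').symm)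
    exact end_notMem_arc h
  · rintro ⟨q, hq, h⟩
    obtain ⟨q', hq', he⟩ := exists_fst_eq_rev (M := M) (r := r) (e := e) hd
    rw [← he] at h
    obtain rfl := eq_of_mem_sidePairs hn hq hq' (tail_eq_tail.2 (sameCycle_of_mem_arc h))
    exact self_notMem_arc h

end Count

open Classical in
/-- A path joining two corners of a face of a plane map has a function of the vertices off the path
that is `0` on its second side and `1` on its first side. Together with the sides of the corners on the path it
extends to the corners, and it is constant along each face except at the two ends of the path. -/
theorem exists_side_function [Fintype D] (hM : M.Connected)
    (hE : Nat.card M.Edge + 2 ≤ Nat.card M.Vert + Nat.card M.Face) {L E : D}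
    (hface : M.face.SameCycle L E) {P : List D} (hP : M.IsWalk (M.tail L) P (M.tail E))
    (hn : (M.support (M.tail L) P).Nodup) :
    ∃ f : M.Vert → ℚ,
      (∀ d, M.tail d ∉ M.support (M.tail L) P → M.head d ∉ M.support (M.tail L) P →
        f (M.head d) = f (M.tail d)) ∧
      (∀ d ∈ M.sideDarts M.rot L (M.rot E) P, M.head d ∉ M.support (M.tail L) P →
        f (M.head d) = 1) ∧
      (∀ d ∉ M.sideDarts M.rot L (M.rot E) P, M.tail d ∈ M.support (M.tail L) P →
        M.head d ∉ M.support (M.tail L) P → f (M.head d) = 0) ∧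
      ∃ h : D → ℚ, (∀ d, M.tail d ∉ M.support (M.tail L) P → h d = f (M.tail d)) ∧ h L = 1 ∧
        h E = 1 ∧ ∀ d, h (M.face d) =
          h d - (if d = L then 1 else 0) + (if M.face d = E then 1 else 0) := by
  have hP' : M.IsWalk (M.tail L) P (M.tail (M.rot E)) := by rwa [tail_rot]
  have hrevE : ∀ d, M.rev d = M.rot E ↔ M.face d = E := by
    intro d
    simp [face, Equiv.symm_apply_eq]
  have hsub := sideCount_sub hP'
  simp only [hrevE] at hsub
  obtain ⟨f, hf⟩ := exists_potential hM hE
    (ψ := fun d => M.sideCount L (M.rot E) P d - M.sideCount L (M.rot E) P (M.rev d))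
    (fun d => by rw [M.rev_rev]; ring) (by
      intro g hg
      -- Against a function g constant on faces, the corner counts cancel by the substitution
      -- `M.face`; what remains is g E - g L, which is zero because L and E lie on one face.
      simp only [hsub]
      have h1 := Equiv.sum_comp M.face fun d => M.cornerCount L (M.rot E) P d * g d
      have h2 := Equiv.sum_comp M.face fun d => (if d = E then 1 else 0) * g d
      simp only [hg, ite_mul, one_mul, zero_mul, Finset.sum_ite_eq', Finset.mem_univ,
        if_true] at h1 h2
      simp only [add_mul, sub_mul, ite_mul, one_mul, zero_mul, Finset.sum_add_distrib,
        Finset.sum_sub_distrib, Finset.sum_ite_eq', Finset.mem_univ, if_true, h1, h2]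
      rw [apply_eq_of_sameCycle hg hface]
      ring)
  -- The darts of the path are counted on neither side, so the potential is constant along it.
  -- Subtracting this constant normalizes the values to 0 and 1.
  have hconst : ∀ w ∈ M.support (M.tail L) P, f w = f (M.tail L) := by
    have : ∀ (l : List D) (u : M.Vert), (∀ d ∈ l, d ∈ P) → M.IsWalk u l (M.tail E) →
        ∀ w ∈ M.support u l, f w = f u := by
      intro l
      induction l with
      | nil => simp
      | cons d l ih =>
        intro u hl hw w hwl
        rcases List.mem_cons.1 hwl with rfl | hwl
        · rfl
        · rw [ih _ (fun d hd => hl d (List.mem_cons_of_mem _ hd)) hw.2 w hwl, ← hw.1]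
          have := hf d
          obtain ⟨h1, h2⟩ := notMem_sideDarts_of_mem_path hP' hn (hl d List.mem_cons_self)
          rw [sideCount_eq_zero h1, sideCount_eq_zero h2] at this
          linarith
    exact this P _ (fun _ h => h) hP
  -- The function on corners adds 1 at the corners of the path that lie on the first side. The two
  -- corners through which the path reaches the face, after L and after E, are attributed to the
  -- first side.
  refine ⟨fun w => f w - f (M.tail L), fun d h1 h2 => ?_, fun d h1 h2 => ?_, fun d h1 h2 h3 => ?_,
    fun d => f (M.tail d) - f (M.tail L) + M.cornerCount L (M.rot E) P d, fun d hd => ?_, ?_, ?_,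
    fun d => ?_⟩
  · have := hf d
    rw [sideCount_eq_zero (notMem_sideDarts_of_tail h1),
      sideCount_eq_zero (notMem_sideDarts_of_tail h2)] at this
    linarith
  · have := hf d
    rw [sideCount_eq_one hn h1, sideCount_eq_zero (notMem_sideDarts_of_tail h2),
      hconst _ (tail_mem_support_of_mem_sideDarts tail_rot h1)] at this
    linarith
  · have := hf d
    rw [sideCount_eq_zero h1, sideCount_eq_zero (notMem_sideDarts_of_tail h3), hconst _ h2] at this
    linarith
  · dsimp only
    rw [cornerCount_eq_zero hd, add_zero]
  · obtain ⟨q, hq, hqL⟩ := fst_mem_sidePairs (M := M) L (M.rot E) P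
    dsimp only
    rw [cornerCount_eq hn hq (by rw [hqL]), if_pos (Or.inl hqL.symm)]
    ring
  · obtain ⟨q, hq, hqE⟩ := snd_mem_sidePairs (M := M) L (M.rot E) P
    have ht := tail_eq_of_mem_sidePairs hP' hq
    have h2 : M.tail q.1 = M.tail E := by rw [ht, hqE, tail_rot]
    dsimp only
    rw [cornerCount_eq hn hq h2, if_pos, hconst _ hP.end_mem_support]
    · ring
    · exact (apply_mem_arc_or_eq (tail_eq_tail.1 ht)).1 (Or.inr hqE.symm)
  · have h1 := hf d
    rw [hsub] at h1
    dsimp only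
    rw [tail_face]
    linarith

/-- A plane map with two sequences of corners, such that the `L i` in increasing order and then the
`E i` in decreasing order are met on the boundary of a face. -/
structure IsSlit (M : CombMap D) {k : ℕ} (L E : Fin (k + 1) → D) : Prop where
  connected : M.Connected
  euler : Nat.card M.Edge + 2 ≤ Nat.card M.Vert + Nat.card M.Face
  face_L : ∀ m : Fin k, M.face (L m.castSucc) = L m.succ
  face_E : ∀ m : Fin k, M.face (E m.succ) = E m.castSucc
  sameCycle : ∀ i j, M.face.SameCycle (L i) (E j)
  injective_L : Function.Injective L
  injective_E : Function.Injective E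
  ne : ∀ i j, L i ≠ E j

/-- Applied to the side function at the successive corners L 0, …, L k, or E 0, …, E k, of the outer
face: its only drop comes just after the index where the path is attached. -/
theorem step_function_eq {k i : ℕ} (hi : i ≤ k) {a : ℕ → ℚ}
    (ha : ∀ n < k, a (n + 1) = a n - if n = i then 1 else 0) (hai : a i = 1) {n : ℕ} (hn : n ≤ k) :
    a n = if n ≤ i then 1 else 0 := by
  have h : ∀ n ≤ k, a n = a 0 - if i < n then 1 else 0 := by
    intro n
    induction n with
    | zero => simp
    | succ n ih =>
      intro hn
      rw [ha n (by omega), ih (by omega)]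
      rcases lt_trichotomy n i with h | rfl | h
      · rw [if_neg (by omega), if_neg (by omega), if_neg (by omega)]; ring
      · rw [if_neg (by omega), if_pos rfl, if_pos (by omega)]; ring
      · rw [if_pos h, if_neg (by omega), if_pos (by omega)]; ring
  have h0 := h i hi
  rw [if_neg (lt_irrefl i), hai, sub_zero] at h0
  rw [h n hn, ← h0]
  by_cases hni : n ≤ i
  · rw [if_pos hni, if_neg (by omega)]; ring
  · rw [if_neg hni, if_pos (by omega)]; ring

/-! ### Separation in a slit map -/

namespace IsSlit

variable [Fintype D] {k : ℕ} {L E : Fin (k + 1) → D}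

/-- The Jordan curve theorem for a path from `L i` to `E j`. -/
theorem exists_separation (hS : M.IsSlit L E) {i j : Fin (k + 1)} {P : List D}
    (hP : M.IsWalk (M.tail (L i)) P (M.tail (E j))) (hn : (M.support (M.tail (L i)) P).Nodup) :
    ∃ f : M.Vert → ℚ,
      (∀ d, M.tail d ∉ M.support (M.tail (L i)) P → M.head d ∉ M.support (M.tail (L i)) P →
        f (M.head d) = f (M.tail d)) ∧
      (∀ w ∈ M.side M.rot (L i) (M.rot (E j)) P, w ∉ M.support (M.tail (L i)) P → f w = 1) ∧
      (∀ w ∈ M.side M.rot⁻¹ (M.rot (L i)) (E j) P, w ∉ M.support (M.tail (L i)) P → f w = 0) ∧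
      (∀ m, M.tail (L m) ∉ M.support (M.tail (L i)) P →
        f (M.tail (L m)) = if m ≤ i then 1 else 0) ∧
      (∀ m, M.tail (E m) ∉ M.support (M.tail (L i)) P →
        f (M.tail (E m)) = if m ≤ j then 1 else 0) := by
  classical
  obtain ⟨f, h1, h2, h3, h, h4, hL, hE, h5⟩ :=
    exists_side_function hS.connected hS.euler (hS.sameCycle i j) hP hn
  have hwalk : ∀ (l : List D) (u w : M.Vert), M.IsWalk u l w →
      (∀ z ∈ M.support u l, z ∉ M.support (M.tail (L i)) P) → f w = f u := by
    intro l
    induction l with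
    | nil => intro u w h _; rw [isWalk_nil.1 h]
    | cons d l ih =>
      intro u w h hz
      rw [ih _ _ h.2 fun z hz' => hz z (List.mem_cons_of_mem _ hz'), h1 d, h.1]
      · rw [h.1]
        exact hz u (start_mem_support _ _)
      · exact hz _ (List.mem_cons_of_mem _ (start_mem_support _ _))
  refine ⟨f, h1, ?_, ?_, fun m hm => ?_, fun m hm => ?_⟩
  · rintro w (hw | ⟨d, hd, l, hl, hlP⟩) hwP
    · exact absurd hw hwP
    · rw [hwalk l _ _ hl hlP, h2 d hd (hlP _ (start_mem_support _ _))]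
  · have hsup : M.support (M.tail (M.rot (L i))) P = M.support (M.tail (L i)) P := by rw [tail_rot]
    rintro w (hw | ⟨d, hd, l, hl, hlP⟩) hwP
    · exact absurd (hsup ▸ hw) hwP
    · rw [hsup] at hlP
      rw [hwalk l _ _ hl hlP, h3 d (notMem_sideDarts_of_mem (hS.ne i j) hP hn hd)
        (hsup ▸ tail_mem_support_of_mem_sideDarts tail_rot_inv hd) (hlP _ (start_mem_support _ _))]
  · rw [← h4 _ hm]
    -- Along the L m the face permutation increases the index, and the corner function drops by 1 on
    -- leaving L i; none of these darts is E j.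
    have := step_function_eq (k := k) (i := i) (n := m) (Nat.lt_succ_iff.1 i.2)
      (a := fun n => if hn : n < k + 1 then h (L ⟨n, hn⟩) else 0) (fun n hn => by
        have hf := hS.face_L ⟨n, hn⟩
        have := h5 (L (Fin.castSucc ⟨n, hn⟩))
        rw [hf, if_neg (hS.ne _ _), add_zero] at this
        simp only [show n + 1 < k + 1 by omega, show n < k + 1 by omega, dif_pos]
        rw [show (⟨n + 1, by omega⟩ : Fin (k + 1)) = Fin.succ ⟨n, hn⟩ from rfl, this]
        congr 1
        refine if_congr ?_ rfl rfl
        rw [hS.injective_L.eq_iff, Fin.ext_iff]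
        rfl) (by rw [dif_pos i.2]; exact hL)
      (Nat.lt_succ_iff.1 m.2)
    rw [dif_pos m.2] at this
    exact this
  · rw [← h4 _ hm]
    -- Along the E m the face permutation decreases the index, so the gain of 1 on arriving at E j
    -- is again a drop from index j to j + 1.
    have := step_function_eq (k := k) (i := j) (n := m) (Nat.lt_succ_iff.1 j.2)
      (a := fun n => if hn : n < k + 1 then h (E ⟨n, hn⟩) else 0) (fun n hn => by
        have hf := hS.face_E ⟨n, hn⟩
        have := h5 (E (Fin.succ ⟨n, hn⟩))
        rw [hf, if_neg (hS.ne _ _).symm, sub_zero] at this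
        simp only [show n + 1 < k + 1 by omega, show n < k + 1 by omega, dif_pos]
        rw [show (⟨n + 1, by omega⟩ : Fin (k + 1)) = Fin.succ ⟨n, hn⟩ from rfl, eq_sub_iff_add_eq]
        rw [show (⟨n, by omega⟩ : Fin (k + 1)) = Fin.castSucc ⟨n, hn⟩ from rfl, this]
        congr 1
        refine if_congr ?_ rfl rfl
        rw [hS.injective_E.eq_iff, Fin.ext_iff]
        rfl) (by rw [dif_pos j.2]; exact hE)
      (Nat.lt_succ_iff.1 m.2)
    rw [dif_pos m.2] at this
    exact this

variable {i j : Fin (k + 1)} {P : List D}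

/-- Off the path, the separating function is 0 at these vertices, which excludes the first side. -/
theorem mem_right_of_lt (hS : M.IsSlit L E) (hP : M.IsWalk (M.tail (L i)) P (M.tail (E j)))
    (hn : (M.support (M.tail (L i)) P).Nodup) {m : Fin (k + 1)} :
    (i < m → M.tail (L m) ∈ M.side M.rot⁻¹ (M.rot (L i)) (E j) P) ∧
      (j < m → M.tail (E m) ∈ M.side M.rot⁻¹ (M.rot (L i)) (E j) P) := by
  obtain ⟨f, -, hl, -, hfL, hfE⟩ := hS.exists_separation hP hn
  have key : ∀ w, (w ∉ M.support (M.tail (L i)) P → f w = 0) →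
      w ∈ M.side M.rot⁻¹ (M.rot (L i)) (E j) P := by
    intro w hw
    by_cases hwP : w ∈ M.support (M.tail (L i)) P
    · exact support_subset_side (by rwa [tail_rot])
    · refine (mem_side_or hS.connected (hS.ne i j) hP hn w).resolve_left fun h => ?_
      exact zero_ne_one ((hw hwP).symm.trans (hl w h hwP))
  exact ⟨fun h => key _ fun h' => by rw [hfL m h', if_neg (not_le.2 h)],
    fun h => key _ fun h' => by rw [hfE m h', if_neg (not_le.2 h)]⟩

theorem mem_left_of_le (hS : M.IsSlit L E) (hP : M.IsWalk (M.tail (L i)) P (M.tail (E j)))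
    (hn : (M.support (M.tail (L i)) P).Nodup) {m : Fin (k + 1)} :
    (m ≤ i → M.tail (L m) ∈ M.side M.rot (L i) (M.rot (E j)) P) ∧
      (m ≤ j → M.tail (E m) ∈ M.side M.rot (L i) (M.rot (E j)) P) := by
  obtain ⟨f, -, -, hr, hfL, hfE⟩ := hS.exists_separation hP hn
  have key : ∀ w, (w ∉ M.support (M.tail (L i)) P → f w = 1) →
      w ∈ M.side M.rot (L i) (M.rot (E j)) P := by
    intro w hw
    by_cases hwP : w ∈ M.support (M.tail (L i)) P
    · exact support_subset_side hwP
    · refine (mem_side_or hS.connected (hS.ne i j) hP hn w).resolve_right fun h => ?_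
      exact zero_ne_one ((hr w h hwP).symm.trans (hw hwP))
  exact ⟨fun h => key _ fun h' => by rw [hfL m h', if_pos h],
    fun h => key _ fun h' => by rw [hfE m h', if_pos h]⟩

theorem mem_support_of_mem_sides (hS : M.IsSlit L E)
    (hP : M.IsWalk (M.tail (L i)) P (M.tail (E j))) (hn : (M.support (M.tail (L i)) P).Nodup)
    {w : M.Vert} (hl : w ∈ M.side M.rot (L i) (M.rot (E j)) P)
    (hr : w ∈ M.side M.rot⁻¹ (M.rot (L i)) (E j) P) : w ∈ M.support (M.tail (L i)) P := by
  obtain ⟨f, -, hl', hr', -, -⟩ := hS.exists_separation hP hn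
  by_contra hw
  exact zero_ne_one ((hr' w hr hw).symm.trans (hl' w hl hw))

/-- A walk between the two sides of a path meets the path. -/
theorem exists_mem_support (hS : M.IsSlit L E) (hP : M.IsWalk (M.tail (L i)) P (M.tail (E j)))
    (hn : (M.support (M.tail (L i)) P).Nodup) {u v : M.Vert} {l : List D} (h : M.IsWalk u l v)
    (hu : u ∈ M.side M.rot (L i) (M.rot (E j)) P)
    (hv : v ∈ M.side M.rot⁻¹ (M.rot (L i)) (E j) P) :
    ∃ z ∈ M.support u l, z ∈ M.support (M.tail (L i)) P := by
  by_cases hvl : v ∈ M.side M.rot (L i) (M.rot (E j)) P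
  · exact ⟨v, h.end_mem_support, hS.mem_support_of_mem_sides hP hn hvl hv⟩
  · exact h.exists_mem_support_of_side hu h.end_mem_support hvl

/-- For `i < j`, walks from `L i` to `E j` and from `L j` to `E i` meet. -/
theorem exists_crossing (hS : M.IsSlit L E) (hij : i < j) {l l' : List D}
    (hl : M.IsWalk (M.tail (L i)) l (M.tail (E j)))
    (hl' : M.IsWalk (M.tail (L j)) l' (M.tail (E i))) :
    ∃ z ∈ M.support (M.tail (L i)) l, z ∈ M.support (M.tail (L j)) l' := by
  -- Separation is available for simple paths only; a crossing with the loop-erased walk is a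
  -- crossing with the original one.
  obtain ⟨P, hP, hn, hsub, -⟩ := hl.exists_nodup
  obtain ⟨z, hz, hzP⟩ := hS.exists_mem_support hP hn hl'.revWalk
    ((hS.mem_left_of_le hP hn).2 hij.le) ((hS.mem_right_of_lt hP hn).1 hij)
  exact ⟨z, hsub z hzP, hl'.mem_support_revWalk.1 hz⟩

end IsSlit

end CombMap

/-! ### Breadth-first visits -/

namespace CombMap

variable {D : Type*} {M : CombMap D} {ρ : Equiv.Perm D}

/-- The position of the dart `d` in the list `cycleFrom ρ b`. -/
noncomputable def scanPos (ρ : Equiv.Perm D) (b d : D) : ℕ := sInf {m | (ρ ^ (m + 1)) b = d}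

/-- The positions of the darts of a path in the scans at the vertices of the path. -/
noncomputable def scanLabels (M : CombMap D) (ρ : Equiv.Perm D) : D → List D → List ℕ
  | _, [] => []
  | r, d :: P => scanPos ρ r d :: M.scanLabels ρ (M.rev d) P

/-- Paths are ordered by length, and then lexicographically. -/
noncomputable def scanKey (M : CombMap D) (ρ : Equiv.Perm D) (r : D) (P : List D) : ℕ ×ₗ List ℕ :=
  toLex (P.length, M.scanLabels ρ r P)

@[simp] theorem back_nil (r : D) : M.back r [] = r := rfl

theorem back_cons (r d : D) (P : List D) : M.back r (d :: P) = M.back (M.rev d) P := by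
  cases h : P.getLast? <;> simp [back, List.getLast?_cons, h]

theorem back_append_singleton (r d : D) (P : List D) : M.back r (P ++ [d]) = M.rev d := by
  simp [back]

theorem IsWalk.tail_back {r : D} {P : List D} {v : M.Vert} (h : M.IsWalk (M.tail r) P v) :
    M.tail (M.back r P) = v := by
  induction P generalizing r with
  | nil => exact h
  | cons d P ih => rw [back_cons]; exact ih h.2

theorem scanLabels_append (r : D) (P Q : List D) :
    M.scanLabels ρ r (P ++ Q) = M.scanLabels ρ r P ++ M.scanLabels ρ (M.back r P) Q := by
  induction P generalizing r with
  | nil => simp [scanLabels]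
  | cons d P ih => simp [scanLabels, ih, back_cons]

theorem length_scanLabels (r : D) (P : List D) : (M.scanLabels ρ r P).length = P.length := by
  induction P generalizing r with
  | nil => rfl
  | cons d P ih => simp [scanLabels, ih]

theorem list_append_lt_append {a b : List ℕ} (h : a < b) (hl : a.length = b.length)
    (c d : List ℕ) : a ++ c < b ++ d := by
  induction a generalizing b with
  | nil => cases b with
    | nil => exact absurd h (lt_irrefl _)
    | cons y b => simp at hl
  | cons x a ih => cases b with
    | nil => simp at hl
    | cons y b =>
      simp only [List.cons_append]
      rw [List.cons_lt_cons_iff] at h ⊢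
      rcases h with h | ⟨rfl, h⟩
      · exact Or.inl h
      · exact Or.inr ⟨rfl, ih h (by simpa using hl)⟩

theorem list_append_cons_lt (a c d : List ℕ) {x y : ℕ} (h : x < y) :
    a ++ x :: c < a ++ y :: d := by
  induction a with
  | nil => exact List.cons_lt_cons_iff.2 (Or.inl h)
  | cons z a ih => exact List.cons_lt_cons_iff.2 (Or.inr ⟨rfl, ih⟩)

theorem scanKey_append_lt {r : D} {P Q : List D} (h : M.scanKey ρ r P < M.scanKey ρ r Q)
    (d e : D) : M.scanKey ρ r (P ++ [d]) < M.scanKey ρ r (Q ++ [e]) := by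
  rw [scanKey, scanKey, Prod.Lex.toLex_lt_toLex] at h ⊢
  simp only [List.length_append, List.length_singleton, scanLabels_append] at h ⊢
  rcases h with h | ⟨h, h'⟩
  · exact Or.inl (by omega)
  · exact Or.inr ⟨by omega, list_append_lt_append h' (by simpa [length_scanLabels] using h) _ _⟩

/-- Between paths of equal length the first divergence decides, whatever follows. -/
theorem scanKey_divergence_lt {r d e : D} {P Q R : List D} (hlen : Q.length = R.length)
    (h : scanPos ρ (M.back r P) d < scanPos ρ (M.back r P) e) :
    M.scanKey ρ r (P ++ d :: Q) < M.scanKey ρ r (P ++ e :: R) := by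
  rw [scanKey, scanKey, Prod.Lex.toLex_lt_toLex]
  refine Or.inr ⟨by simp [hlen], ?_⟩
  simp only [scanLabels_append, scanLabels]
  exact list_append_cons_lt _ _ _ h

theorem scanKey_nil_lt (r d : D) (P : List D) :
    M.scanKey ρ r [] < M.scanKey ρ r (P ++ [d]) := by
  rw [scanKey, scanKey, Prod.Lex.toLex_lt_toLex]
  exact Or.inl (by simp)

theorem scanPos_lt_of_mem_arc [Finite D] {b o d : D} (ho : ρ.SameCycle b o)
    (hd : d ∈ arc ρ b o) : scanPos ρ b d < scanPos ρ b o := by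
  obtain ⟨-, n, rfl, hn⟩ := hd
  obtain ⟨m, hm0, -, rfl⟩ := ho.exists_pow_eq''
  have hne : {k | (ρ ^ (k + 1)) b = (ρ ^ m) b}.Nonempty := ⟨m - 1, by
    rw [Set.mem_ofPred_eq, Nat.sub_add_cancel hm0]⟩
  have h1 : scanPos ρ b ((ρ ^ (n + 1)) b) ≤ n := Nat.sInf_le rfl
  have h2 : (ρ ^ (scanPos ρ b ((ρ ^ m) b) + 1)) b = (ρ ^ m) b := Nat.sInf_mem hne
  by_contra hc
  exact hn _ (by omega) h2

section Cycle

variable [Finite D]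

theorem minimalPeriod_spec (ρ : Equiv.Perm D) (b : D) :
    0 < Function.minimalPeriod ρ b ∧ (ρ ^ Function.minimalPeriod ρ b) b = b ∧
      ∀ m, 0 < m → m < Function.minimalPeriod ρ b → (ρ ^ m) b ≠ b := by
  refine ⟨Function.minimalPeriod_pos_of_mem_periodicPts
    (ρ.injective.mem_periodicPts b), ?_, fun m h0 hm he => ?_⟩
  · have := Function.iterate_minimalPeriod (f := ρ) (x := b)
    rwa [Equiv.Perm.iterate_eq_pow] at this
  · refine Function.not_isPeriodicPt_of_pos_of_lt_minimalPeriod h0.ne' hm ?_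
    rwa [Function.IsPeriodicPt, Function.IsFixedPt, Equiv.Perm.iterate_eq_pow]

theorem mem_cycleFrom {b d : D} : d ∈ cycleFrom ρ b ↔ ρ.SameCycle b d := by
  constructor
  · intro h
    obtain ⟨m, -, rfl⟩ := List.mem_map.1 h
    exact ⟨(m + 1 : ℕ), by simp only [zpow_natCast]⟩
  · intro h
    obtain ⟨h0, hT, -⟩ := minimalPeriod_spec ρ b
    obtain ⟨m, hm0, hm, rfl⟩ := exists_pos_of_sameCycle h0 hT h
    exact List.mem_map.2 ⟨m - 1, by simp; omega, by rw [Nat.sub_add_cancel hm0]⟩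

theorem pairwise_cycleFrom (b : D) :
    (cycleFrom ρ b).Pairwise fun d e => scanPos ρ b d < scanPos ρ b e := by
  obtain ⟨h0, hT, hmin⟩ := minimalPeriod_spec ρ b
  have hpos : ∀ m < Function.minimalPeriod ρ b, scanPos ρ b ((ρ ^ (m + 1)) b) = m := by
    intro m hm
    have h1 : scanPos ρ b ((ρ ^ (m + 1)) b) ≤ m := Nat.sInf_le rfl
    have h2 : (ρ ^ (scanPos ρ b ((ρ ^ (m + 1)) b) + 1)) b = (ρ ^ (m + 1)) b :=
      Nat.sInf_mem (s := {k | (ρ ^ (k + 1)) b = (ρ ^ (m + 1)) b}) ⟨m, rfl⟩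
    have := pow_apply_injOn hmin (by omega) (by omega) (by omega) (by omega) h2
    omega
  rw [cycleFrom, List.pairwise_map]
  refine List.pairwise_lt_range.imp_of_mem fun {x y} hx hy hxy => ?_
  rwa [hpos x (List.mem_range.1 hx), hpos y (List.mem_range.1 hy)]

end Cycle

/-- The properties of the list of discovered paths that do not depend on the progress of the visit:
it is increasing, it has one path for each discovered vertex, and it holds the empty path. -/
structure IsTreeList (M : CombMap D) (ρ : Equiv.Perm D) (r : D) (F : List (List D)) : Prop where
  sorted : F.Pairwise fun P Q => M.scanKey ρ r P < M.scanKey ρ r Q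
  nodup : (F.map fun P => M.tail (M.back r P)).Nodup
  walk : ∀ P ∈ F, M.IsWalk (M.tail r) P (M.tail (M.back r P))
  nil_mem : [] ∈ F

/-- The candidate `P` is dominated by a discovered path with the same end. -/
def Dominated (M : CombMap D) (ρ : Equiv.Perm D) (r : D) (F : List (List D)) (P : List D) : Prop :=
  ∃ Q ∈ F, M.tail (M.back r Q) = M.tail (M.back r P) ∧
    (M.scanKey ρ r Q < M.scanKey ρ r P ∨ Q = P)

theorem Dominated.mono {r : D} {F F' : List (List D)} {P : List D} (h : M.Dominated ρ r F P)
    (hF : F ⊆ F') : M.Dominated ρ r F' P := by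
  obtain ⟨Q, hQ, h⟩ := h
  exact ⟨Q, hF hQ, h⟩

open Classical in
/-- One step of the scan at the end of the path `P`. -/
noncomputable def scanStep (M : CombMap D) (r : D) (P : List D) (F : List (List D)) (d : D) :
    List (List D) :=
  if ∃ Q ∈ F, M.tail (M.back r Q) = M.head d then F else F ++ [P ++ [d]]

/-- The invariant of scanning one vertex, where S holds the darts scanned so far: each discovered
path either precedes all one-dart extensions of P or is an extension by a dart of S. A new extension
is therefore later than everything in the list, so the list stays sorted, and a candidate that is
rejected is beaten by an earlier path. -/
theorem foldl_scanStep {r : D} {P : List D} (l : List D) {S : Set D} {F : List (List D)}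
    (hF : M.IsTreeList ρ r F) (hPF : P ∈ F) (hl : ∀ d ∈ l, M.tail d = M.tail (M.back r P))
    (hsort : l.Pairwise fun d e => scanPos ρ (M.back r P) d < scanPos ρ (M.back r P) e)
    (hS : ∀ d ∈ S, ∀ e ∈ l, scanPos ρ (M.back r P) d < scanPos ρ (M.back r P) e)
    (hold : ∀ Q ∈ F, (∀ d, M.scanKey ρ r Q < M.scanKey ρ r (P ++ [d])) ∨
      ∃ d ∈ S, Q = P ++ [d]) :
    M.IsTreeList ρ r (l.foldl (M.scanStep r P) F) ∧ F <+: l.foldl (M.scanStep r P) F ∧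
      (∀ d ∈ l, M.Dominated ρ r (l.foldl (M.scanStep r P) F) (P ++ [d])) ∧
      ∀ Q ∈ l.foldl (M.scanStep r P) F, (∀ d, M.scanKey ρ r Q < M.scanKey ρ r (P ++ [d])) ∨
        ∃ d, Q = P ++ [d] := by
  induction l generalizing S F with
  | nil =>
    refine ⟨hF, List.prefix_rfl, by simp, fun Q hQ => ?_⟩
    rcases hold Q hQ with h | ⟨d, -, h⟩
    · exact Or.inl h
    · exact Or.inr ⟨d, h⟩
  | cons d l ih =>
    obtain ⟨hd, hsort⟩ := List.pairwise_cons.1 hsort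
    have hlt : ∀ Q ∈ F, M.scanKey ρ r Q < M.scanKey ρ r (P ++ [d]) := by
      intro Q hQ
      rcases hold Q hQ with h | ⟨e, he, rfl⟩
      · exact h d
      · exact scanKey_divergence_lt rfl (hS e he d List.mem_cons_self)
    have hend : M.tail (M.back r (P ++ [d])) = M.head d := by rw [back_append_singleton]; rfl
    have hpre : F <+: M.scanStep r P F d := by
      rw [scanStep]
      split_ifs
      · exact List.prefix_rfl
      · exact List.prefix_append _ _
    have hF' : M.IsTreeList ρ r (M.scanStep r P F d) := by
      rw [scanStep]
      split_ifs with hc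
      · exact hF
      · refine ⟨?_, ?_, ?_, List.mem_append_left _ hF.nil_mem⟩
        · rw [List.pairwise_append]
          refine ⟨hF.sorted, List.pairwise_singleton _ _, fun Q hQ R hR => ?_⟩
          rw [List.mem_singleton.1 hR]
          exact hlt Q hQ
        · rw [List.map_append, List.nodup_append]
          refine ⟨hF.nodup, by simp, ?_⟩
          intro a ha b hb hab
          obtain ⟨Q, hQ, rfl⟩ := List.mem_map.1 ha
          rw [List.map_singleton, List.mem_singleton] at hb
          exact hc ⟨Q, hQ, by rw [hab, hb, hend]⟩
        · intro Q hQ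
          rcases List.mem_append.1 hQ with hQ | hQ
          · exact hF.walk Q hQ
          · rw [List.mem_singleton.1 hQ, hend]
            exact (hF.walk P hPF).append
              (isWalk_singleton.2 ⟨hl d List.mem_cons_self, rfl⟩)
    have hdom : M.Dominated ρ r (M.scanStep r P F d) (P ++ [d]) := by
      rw [scanStep]
      split_ifs with hc
      · obtain ⟨Q, hQ, hQd⟩ := hc
        exact ⟨Q, hQ, hQd.trans hend.symm, Or.inl (hlt Q hQ)⟩
      · exact ⟨P ++ [d], by simp, rfl, Or.inr rfl⟩
    obtain ⟨h1, h2, h3, h4⟩ := ih (S := insert d S) hF' (hpre.subset hPF)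
      (fun e he => hl e (List.mem_cons_of_mem _ he)) hsort (by
        rintro e (rfl | he) e' he'
        · exact hd e' he'
        · exact hS e he e' (List.mem_cons_of_mem _ he')) (by
        intro Q hQ
        rw [scanStep] at hQ
        split_ifs at hQ
        · rcases hold Q hQ with h | ⟨e, he, h⟩
          · exact Or.inl h
          · exact Or.inr ⟨e, Or.inr he, h⟩
        · rcases List.mem_append.1 hQ with hQ | hQ
          · rcases hold Q hQ with h | ⟨e, he, h⟩
            · exact Or.inl h
            · exact Or.inr ⟨e, Or.inr he, h⟩
          · exact Or.inr ⟨d, Or.inl rfl, List.mem_singleton.1 hQ⟩)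
    refine ⟨h1, hpre.trans h2, fun e he => ?_, h4⟩
    rcases List.mem_cons.1 he with rfl | he
    · exact hdom.mono h2.subset
    · exact h3 e he

/-- The last clause keeps the induction going: whatever is discovered precedes the extensions of the
next path P in the queue. It passes to the following path R, since P precedes R and thus the
extensions of P precede those of R. -/
theorem bfs_spec [Finite D] (hρ : ∀ d e, M.tail d = M.tail e ↔ ρ.SameCycle d e) (r : D) (n : ℕ) :
    M.IsTreeList ρ r (M.bfs ρ r n) ∧
      (∀ m < n, ∀ P, (M.bfs ρ r n)[m]? = some P → ∀ d, M.tail d = M.tail (M.back r P) →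
        M.Dominated ρ r (M.bfs ρ r n) (P ++ [d])) ∧
      ∀ P, (M.bfs ρ r n)[n]? = some P → ∀ Q ∈ M.bfs ρ r n, ∀ d,
        M.scanKey ρ r Q < M.scanKey ρ r (P ++ [d]) := by
  induction n with
  | zero =>
    refine ⟨⟨by simp [bfs], by simp [bfs], ?_, by simp [bfs]⟩, by simp, ?_⟩
    · intro P hP
      simp only [bfs, List.mem_singleton] at hP
      subst hP
      rfl
    · intro P hP Q hQ d
      simp only [bfs, List.mem_singleton] at hQ
      subst hQ
      exact scanKey_nil_lt _ _ _
  | succ n ih =>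
    obtain ⟨h1, h2, h3⟩ := ih
    rcases hP : (M.bfs ρ r n)[n]? with _ | P
    · have : M.bfs ρ r (n + 1) = M.bfs ρ r n := by rw [bfs, hP]
      rw [this]
      refine ⟨h1, fun m hm P hmP => ?_, fun P hmP => ?_⟩
      · rcases Nat.lt_succ_iff_lt_or_eq.1 hm with h | rfl
        · exact h2 m h P hmP
        · simp [hP] at hmP
      · rw [List.getElem?_eq_none_iff] at hP
        rw [List.getElem?_eq_none (by omega)] at hmP
        simp at hmP
    · have : M.bfs ρ r (n + 1) =
          (cycleFrom ρ (M.back r P)).foldl (M.scanStep r P) (M.bfs ρ r n) := by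
        rw [bfs, hP]
        rfl
      obtain ⟨h4, h5, h6, h7⟩ := foldl_scanStep (S := ∅) (cycleFrom ρ (M.back r P)) h1
        (List.mem_of_getElem? hP) (fun d hd => ((hρ _ _).2 (mem_cycleFrom.1 hd)).symm)
        (pairwise_cycleFrom _) (by simp) (fun Q hQ => Or.inl (h3 P hP Q hQ))
      rw [← this] at h4 h5 h6 h7
      have hlen : n < (M.bfs ρ r n).length := (List.getElem?_eq_some_iff.1 hP).1
      have hget : ∀ m ≤ n, (M.bfs ρ r (n + 1))[m]? = (M.bfs ρ r n)[m]? := by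
        intro m hm
        obtain ⟨t, ht⟩ := h5
        rw [← ht, List.getElem?_append_left (by omega)]
      refine ⟨h4, fun m hm R hR d hd => ?_, fun R hR Q hQ d => ?_⟩
      · rcases Nat.lt_succ_iff_lt_or_eq.1 hm with h | rfl
        · rw [hget m h.le] at hR
          exact (h2 m h R hR d hd).mono h5.subset
        · rw [hget m le_rfl, hP] at hR
          cases hR
          exact h6 d (mem_cycleFrom.2 ((hρ _ _).1 hd.symm))
      · have hPR : M.scanKey ρ r P < M.scanKey ρ r R := by
          rw [← hget n le_rfl] at hP
          obtain ⟨a, rfl⟩ := List.getElem?_eq_some_iff.1 hP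
          obtain ⟨b, rfl⟩ := List.getElem?_eq_some_iff.1 hR
          exact List.pairwise_iff_getElem.1 h4.sorted n (n + 1) a b (by omega)
        rcases h7 Q hQ with h | ⟨e, rfl⟩
        · exact (h d).trans (scanKey_append_lt hPR d d)
        · exact scanKey_append_lt hPR e d

theorem length_bfs_le [Finite D] {r : D} {F : List (List D)} (hF : M.IsTreeList ρ r F) :
    F.length ≤ Nat.card D := by
  have := Fintype.ofFinite M.Vert
  have h1 := hF.nodup.length_le_card
  rw [List.length_map, ← Nat.card_eq_fintype_card] at h1
  exact h1.trans (Nat.card_le_card_of_surjective M.tail tail_surjective)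

/-- The path of the breadth-first visit is the first of all walks with the same ends. -/
theorem bfsPath_spec [Finite D] (hρ : ∀ d e, M.tail d = M.tail e ↔ ρ.SameCycle d e) {r : D}
    {W : List D} {v : M.Vert} (hW : M.IsWalk (M.tail r) W v) :
    M.IsWalk (M.tail r) (M.bfsPath ρ r v) v ∧
      M.scanKey ρ r (M.bfsPath ρ r v) ≤ M.scanKey ρ r W := by
  classical
  obtain ⟨h1, h2, -⟩ := bfs_spec hρ r (Nat.card D)
  have hlen := length_bfs_le h1
  set F := M.bfs ρ r (Nat.card D) with hF
  -- The list has one entry per discovered vertex, hence at most `Nat.card D` entries; after that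
  -- many rounds all of them have been processed.
  have hdom : ∀ P ∈ F, ∀ d, M.tail d = M.tail (M.back r P) → M.Dominated ρ r F (P ++ [d]) := by
    intro P hP d hd
    obtain ⟨m, hm, rfl⟩ := List.mem_iff_getElem.1 hP
    exact h2 m (by omega) _ (List.getElem?_eq_getElem hm) d hd
  -- Induction on the last dart: replace the initial part of the walk by the path Q that dominates
  -- it, which makes the key no larger, and then Q followed by the last dart is itself dominated.
  have key : ∀ (W : List D) (v : M.Vert), M.IsWalk (M.tail r) W v →
      ∃ Q ∈ F, M.tail (M.back r Q) = v ∧ (M.scanKey ρ r Q < M.scanKey ρ r W ∨ Q = W) := by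
    intro W
    induction W using List.reverseRecOn with
    | nil => exact fun v hv => ⟨[], h1.nil_mem, hv, Or.inr rfl⟩
    | append_singleton W d ih =>
      intro v hv
      obtain ⟨w, hw, hd⟩ := isWalk_append.1 hv
      obtain ⟨Q, hQ, hQw, hle⟩ := ih w hw
      obtain ⟨hdw, rfl⟩ := isWalk_singleton.1 hd
      obtain ⟨R, hR, hRd, hlt⟩ := hdom Q hQ d (hdw.trans hQw.symm)
      refine ⟨R, hR, by rw [hRd, back_append_singleton]; rfl, ?_⟩
      rcases hle with hle | rfl
      · have hle := scanKey_append_lt hle d d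
        rcases hlt with hlt | rfl
        · exact Or.inl (hlt.trans hle)
        · exact Or.inl hle
      · exact hlt
  obtain ⟨Q, hQ, hQv, hle⟩ := key W v hW
  have hpath : M.bfsPath ρ r v = Q := by
    rw [bfsPath]
    rcases hf : F.find? (fun P => M.tail (M.back r P) = v) with _ | R
    · rw [List.find?_eq_none] at hf
      exact absurd hQv (by simpa using hf Q hQ)
    · have hR := List.mem_of_find?_eq_some hf
      have hRv := List.find?_some hf
      have hRv : M.tail (M.back r R) = v := by simpa using hRv
      rw [Option.getD_some]
      exact List.inj_on_of_nodup_map h1.nodup hR hQ (hRv.trans hQv.symm)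
  rw [hpath]
  exact ⟨hQv ▸ h1.walk Q hQ, hle.elim le_of_lt fun h => h ▸ le_rfl⟩

section ShortestPath

variable [Finite D] {r : D} {v : M.Vert}

theorem bfsPath_isShortest (hρ : ∀ d e, M.tail d = M.tail e ↔ ρ.SameCycle d e) (hM : M.Connected) :
    M.IsShortest (M.tail r) (M.bfsPath ρ r v) v := by
  obtain ⟨W, hW⟩ := hM (M.tail r) v
  refine ⟨(bfsPath_spec hρ hW).1, fun l hl => ?_⟩
  have := (bfsPath_spec hρ hl).2
  rw [scanKey, scanKey, Prod.Lex.toLex_le_toLex] at this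
  rcases this with h | h
  · exact h.le
  · exact h.1.le

/-- No shortest path leaves the path of the breadth-first visit by a dart that is scanned before the
one followed by that path. -/
theorem bfsPath_notMem_arc (hρ : ∀ d e, M.tail d = M.tail e ↔ ρ.SameCycle d e) {P Q R : List D} {d o : D} (hP : M.bfsPath ρ r v = P ++ o :: Q)
    (hR : M.IsShortest (M.tail r) (P ++ d :: R) v) : d ∉ arc ρ (M.back r P) o := by
  intro hd
  obtain ⟨hw, hle⟩ := bfsPath_spec hρ hR.1
  rw [hP] at hw hle
  have hlen := hR.2 _ hw
  rw [scanKey, scanKey, Prod.Lex.toLex_le_toLex] at hle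
  simp only [List.length_append, List.length_cons] at hlen hle
  obtain ⟨w, hPw, ho⟩ := isWalk_append.1 hw
  have ho' : ρ.SameCycle (M.back r P) o := (hρ _ _).1 (hPw.tail_back.trans ho.1.symm)
  have hlt := scanKey_divergence_lt (M := M) (r := r) (P := P) (Q := R) (R := Q) (by omega)
    (scanPos_lt_of_mem_arc ho' hd)
  have := (bfsPath_spec hρ hR.1).2
  rw [hP] at this
  exact absurd this (not_le.2 hlt)

end ShortestPath

end CombMap

/-! ### Shortest paths and sides -/

namespace CombMap

variable {D : Type*} {M : CombMap D}

theorem IsShortest.middle {u a b v : M.Vert} {A B C : List D}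
    (h : M.IsShortest u (A ++ B ++ C) v) (hA : M.IsWalk u A a) (hB : M.IsWalk a B b)
    (hC : M.IsWalk b C v) : M.IsShortest a B b :=
  (h.left (hA.append hB) hC).right hA hB

theorem IsWalk.exists_segment {s t a b : M.Vert} {P : List D} (h : M.IsWalk s P t)
    (ha : a ∈ M.support s P) (hb : b ∈ M.support s P) : ∃ P₁ Z P₂, P = P₁ ++ Z ++ P₂ ∧
      ((M.IsWalk s P₁ a ∧ M.IsWalk a Z b ∧ M.IsWalk b P₂ t) ∨
        (M.IsWalk s P₁ b ∧ M.IsWalk b Z a ∧ M.IsWalk a P₂ t)) := by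
  obtain ⟨X, Y, rfl, hX, hY⟩ := h.split ha
  rcases hX.mem_support_append.1 hb with hb | hb
  · obtain ⟨X₁, X₂, rfl, h1, h2⟩ := hX.split hb
    exact ⟨X₁, X₂, Y, rfl, Or.inr ⟨h1, h2, hY⟩⟩
  · obtain ⟨Y₁, Y₂, rfl, h1, h2⟩ := hY.split hb
    exact ⟨X, Y₁, Y₂, by simp, Or.inl ⟨hX, h1, h2⟩⟩

/-- Two vertices of a shortest path are joined by a shortest path along it. -/
theorem IsShortest.exists_shortest_between {s t a b : M.Vert} {P : List D}
    (h : M.IsShortest s P t) (ha : a ∈ M.support s P) (hb : b ∈ M.support s P) :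
    ∃ Z, M.IsShortest a Z b ∧ ∀ z ∈ M.support a Z, z ∈ M.support s P := by
  obtain ⟨P₁, Z, P₂, rfl, ⟨h1, h2, h3⟩ | ⟨h1, h2, h3⟩⟩ := h.1.exists_segment ha hb
  · exact ⟨Z, h.middle h1 h2 h3, fun z hz => (h1.append h2).mem_support_append.2
      (Or.inl (h1.mem_support_append.2 (Or.inr hz)))⟩
  · exact ⟨M.revWalk Z, (h.middle h1 h2 h3).revWalk, fun z hz =>
      (h1.append h2).mem_support_append.2
      (Or.inl (h1.mem_support_append.2 (Or.inr (h2.mem_support_revWalk.1 hz))))⟩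

/-- A walk that leaves a side of a path does it from a vertex of the path, and if it ends on that
side, it meets the path again. -/
theorem IsWalk.exists_excursion {ρ : Equiv.Perm D} {r e : D} {P l : List D} {u v w : M.Vert}
    (h : M.IsWalk u l v) (hu : u ∈ M.side ρ r e P) (hv : v ∈ M.side ρ r e P)
    (hw : w ∈ M.support u l) (hwS : w ∉ M.side ρ r e P) :
    ∃ A d B C b, l = A ++ (d :: B) ++ C ∧ M.IsWalk u A (M.tail d) ∧ M.IsWalk (M.head d) B b ∧
      M.IsWalk b C v ∧ (∀ z ∈ M.support u A, z ∈ M.side ρ r e P) ∧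
      M.tail d ∈ M.support (M.tail r) P ∧ b ∈ M.support (M.tail r) P ∧
      M.head d ∉ M.side ρ r e P := by
  obtain ⟨A, d, B, rfl, hA, hB, hS, hd⟩ := h.exists_exit hu hw hwS
  have htd : M.tail d ∈ M.support (M.tail r) P := by
    by_contra hc
    exact hd (head_mem_side_of_tail_mem (hS _ hA.end_mem_support) hc)
  obtain ⟨b, hb, hbP⟩ := hB.revWalk.exists_mem_support_of_side hv hB.revWalk.end_mem_support hd
  obtain ⟨B, C, rfl, hB, hC⟩ := hB.split (hB.mem_support_revWalk.1 hb)
  exact ⟨A, d, B, C, b, by simp, hA, hB, hC, hS, htd, hbP, hd⟩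

/-- A side of a shortest path is an isometric subgraph. -/
theorem IsShortest.exists_walk_in_side {ρ : Equiv.Perm D} {r e : D} {P : List D} {t : M.Vert}
    (hP : M.IsShortest (M.tail r) P t) (l : List D) {u v : M.Vert} (h : M.IsWalk u l v)
    (hu : u ∈ M.side ρ r e P) (hv : v ∈ M.side ρ r e P) :
    ∃ l', M.IsWalk u l' v ∧ (∀ z ∈ M.support u l', z ∈ M.side ρ r e P) ∧
      l'.length ≤ l.length := by
  by_cases hall : ∀ z ∈ M.support u l, z ∈ M.side ρ r e P
  · exact ⟨l, h, hall, le_rfl⟩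
  push Not at hall
  obtain ⟨w, hw, hwS⟩ := hall
  obtain ⟨A, d, B, C, b, hl, hA, hB, hC, hS, hd, hb, -⟩ := h.exists_excursion hu hv hw hwS
  obtain ⟨Z, hZ, hZP⟩ := hP.exists_shortest_between hd hb
  have hlen : C.length < l.length := by simp [hl]; omega
  obtain ⟨C', hC', hCS, hClen⟩ := hP.exists_walk_in_side C hC (support_subset_side hb) hv
  refine ⟨A ++ (Z ++ C'), hA.append (hZ.1.append hC'), fun z hz => ?_, ?_⟩
  · rcases hA.mem_support_append.1 hz with hz | hz
    · exact hS z hz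
    · rcases hZ.1.mem_support_append.1 hz with hz | hz
      · exact support_subset_side (hZP z hz)
      · exact hCS z hz
  · have := hZ.2 (d :: B) ⟨rfl, hB⟩
    simp only [hl, List.length_append, List.length_cons] at this ⊢
    omega
termination_by l.length

theorem mem_induce_isWalk {S : Set M.Vert} {u v : M.Vert} {l : List D} :
    (M.induce S).IsWalk u l v ↔ M.IsWalk u l v ∧ ∀ z ∈ M.support u l, z ∈ S := by
  constructor
  · exact fun h => ⟨h.1, h.2.1⟩
  · exact fun h => ⟨h.1, h.2, fun d hd =>
      ⟨h.2 _ (h.1.tail_mem_support hd), h.2 _ (head_mem_support hd)⟩⟩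

/-- Nothing about H matters: a side of a shortest path is isometric in the whole map, hence in any
subgraph that contains it. -/
theorem dist_union_side_eq {ρ : Equiv.Perm D} {r e : D} {P : List D} {t : M.Vert}
    (hP : M.IsShortest (M.tail r) P t) (H : M.Sub) {u v : M.Vert}
    (hu : u ∈ M.side ρ r e P) (hv : v ∈ M.side ρ r e P) :
    (M.induce (M.side ρ r e P) ∪ H).dist u v = (M.induce (M.side ρ r e P)).dist u v := by
  refine le_antisymm ?_ ?_
  · refine le_iInf₂ fun l hl => iInf₂_le l ⟨hl.1, fun w hw => Or.inl (hl.2.1 w hw),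
      fun d hd => Or.inl (hl.2.2 d hd)⟩
  · refine le_iInf₂ fun l hl => ?_
    obtain ⟨l', hl', hS, hlen⟩ := hP.exists_walk_in_side l hl.1 hu hv
    exact (iInf₂_le l' (mem_induce_isWalk.2 ⟨hl', hS⟩)).trans (by exact_mod_cast hlen)

theorem mem_sidePairs_append (r e o : D) (P Q : List D) :
    (M.back r P, o) ∈ M.sidePairs r e (P ++ o :: Q) := by
  induction P generalizing r with
  | nil => simp
  | cons d P ih => rw [back_cons]; exact List.mem_cons_of_mem _ (ih _)

theorem sameCycle_rot (d e : D) : M.tail d = M.tail e ↔ M.rot.SameCycle d e := tail_eq_tail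

theorem sameCycle_rot_inv (d e : D) : M.tail d = M.tail e ↔ M.rot⁻¹.SameCycle d e := by
  rw [tail_eq_tail, Equiv.Perm.sameCycle_inv]

/-- Every shortest path lies on the second side of the first path of the visit by `rot`. -/
theorem mem_side_bfsPath [Finite D] (hM : M.Connected) {L E : D} (hLE : L ≠ E) {W : List D}
    (hW : M.IsShortest (M.tail L) W (M.tail E)) {w : M.Vert} (hw : w ∈ M.support (M.tail L) W) :
    w ∈ M.side M.rot⁻¹ (M.rot L) E (M.bfsPath M.rot L (M.tail E)) := by
  have hP : M.IsShortest (M.tail L) (M.bfsPath M.rot L (M.tail E)) (M.tail E) :=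
    bfsPath_isShortest sameCycle_rot hM
  by_contra hwS
  have hsup : ∀ P, M.support (M.tail (M.rot L)) P = M.support (M.tail L) P := by simp [tail_rot]
  obtain ⟨A, d, B, rfl, hA, hB, hS, hd⟩ := hW.1.exists_exit
    (S := M.side M.rot⁻¹ (M.rot L) E (M.bfsPath M.rot L (M.tail E)))
    (support_subset_side (by rw [hsup]; exact start_mem_support _ _)) hw hwS
  have htd : M.tail d ∈ M.support (M.tail L) (M.bfsPath M.rot L (M.tail E)) := by
    by_contra hc
    exact hd (head_mem_side_of_tail_mem (hS _ hA.end_mem_support) (by rwa [hsup]))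
  have hhd : M.head d ∉ M.support (M.tail L) (M.bfsPath M.rot L (M.tail E)) :=
    fun h => hd (support_subset_side (by rwa [hsup]))
  rcases mem_sideDarts_or hLE hP.1 hP.nodup_support htd (fun h => hhd (head_mem_support h))
    (fun h => hhd (hP.1.tail_mem_support h)) with h | h
  -- Follow the visit's path to the tail of d and the given shortest path from there on. The result
  -- is again a shortest path, and it diverges by a dart scanned before the one the visit takes.
  · obtain ⟨q, hq, hdq⟩ := h
    obtain ⟨P₁, P₂, hP', h1, h2⟩ := hP.1.split htd
    have hn := hP.nodup_support
    rw [hP'] at hP hq hn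
    have hl1 := (hP.left h1 h2).length_eq (hW.left hA ⟨rfl, hB⟩)
    have hl2 := (hP.right h1 h2).length_eq (hW.right hA ⟨rfl, hB⟩)
    obtain _ | ⟨o, P₂⟩ := P₂
    · simp at hl2
    · have hR : M.IsShortest (M.tail L) (P₁ ++ d :: B) (M.tail E) :=
        hW.of_length_le (h1.append ⟨rfl, hB⟩) (by simp [hl1])
      refine bfsPath_notMem_arc sameCycle_rot hP' hR ?_
      have := eq_of_mem_sidePairs hn hq (mem_sidePairs_append L (M.rot E) o P₁ P₂) (by
        rw [h1.tail_back]
        exact tail_eq_tail.2 (sameCycle_of_mem_arc hdq))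
      rwa [this] at hdq
  · exact hd (head_mem_side h)

/-- The second side of the first path of the visit by `rot` contains the shortest paths between its
vertices. -/
theorem IsShortest.mem_side_bfsPath [Finite D] (hM : M.Connected) {L E : D} (hLE : L ≠ E)
    {u v w : M.Vert} {l : List D} (hl : M.IsShortest u l v)
    (hu : u ∈ M.side M.rot⁻¹ (M.rot L) E (M.bfsPath M.rot L (M.tail E)))
    (hv : v ∈ M.side M.rot⁻¹ (M.rot L) E (M.bfsPath M.rot L (M.tail E)))
    (hw : w ∈ M.support u l) :
    w ∈ M.side M.rot⁻¹ (M.rot L) E (M.bfsPath M.rot L (M.tail E)) := by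
  have hP : M.IsShortest (M.tail L) (M.bfsPath M.rot L (M.tail E)) (M.tail E) :=
    bfsPath_isShortest sameCycle_rot hM
  by_contra hwS
  obtain ⟨A, d, B, C, b, rfl, hA, hB, hC, -, hdP, hbP, hd⟩ := hl.1.exists_excursion hu hv hw hwS
  rw [tail_rot] at hdP hbP
  have hdB : M.IsWalk (M.tail d) (d :: B) b := ⟨rfl, hB⟩
  have hZ := hl.middle hA hdB hC
  -- The excursion and the segment Z of the visit's path are shortest between the same vertices.
  -- Substituting the excursion for Z, reversed if its end comes first on the path, gives a shortest
  -- path that is not on the second side.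
  obtain ⟨P₁, Z, P₂, hP', ⟨h1, h2, h3⟩ | ⟨h1, h2, h3⟩⟩ := hP.1.exists_segment hdP hbP
  all_goals rw [hP'] at hP
  · have hlen := hZ.length_eq (hP.middle h1 h2 h3)
    refine hd (CombMap.mem_side_bfsPath hM hLE (hP.of_length_le ((h1.append hdB).append h3) ?_) ?_)
    · simp only [List.length_append]; omega
    · exact (h1.append hdB).mem_support_append.2 (Or.inl (h1.mem_support_append.2
        (Or.inr (List.mem_cons_of_mem _ (start_mem_support _ _)))))
  · have hlen := hZ.revWalk.length_eq (hP.middle h1 h2 h3)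
    refine hd (CombMap.mem_side_bfsPath hM hLE
      (hP.of_length_le ((h1.append hdB.revWalk).append h3) ?_) ?_)
    · simp only [List.length_append]; omega
    · exact (h1.append hdB.revWalk).mem_support_append.2 (Or.inl (h1.mem_support_append.2
        (Or.inr (hdB.mem_support_revWalk.2 (List.mem_cons_of_mem _ (start_mem_support _ _))))))

/-! ### Comparing the shortest paths of two indices -/

namespace IsSlit

variable [Fintype D] {k : ℕ} {L E : Fin (k + 1) → D} {i j : Fin (k + 1)}

/-- A shortest path from `L j` to `E j` visits the vertices of a shortest path from `L i` to `E i` in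
the same order. -/
theorem exists_shortest_through (hS : M.IsSlit L E) (hij : i ≠ j) {P A B C : List D}
    {u v a b : M.Vert} (hP : M.IsShortest (M.tail (L i)) P (M.tail (E i)))
    (hA : M.IsWalk (M.tail (L j)) A u) (hB : M.IsWalk u B v) (hC : M.IsWalk v C (M.tail (E j)))
    (hABC : M.IsShortest (M.tail (L j)) (A ++ B ++ C) (M.tail (E j)))
    (haA : a ∈ M.support (M.tail (L j)) A) (haP : a ∈ M.support (M.tail (L i)) P)
    (hbC : b ∈ M.support v C) (hbP : b ∈ M.support (M.tail (L i)) P) :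
    ∃ A' C', M.IsWalk (M.tail (L i)) A' u ∧ M.IsWalk v C' (M.tail (E i)) ∧
      M.IsShortest (M.tail (L i)) (A' ++ B ++ C') (M.tail (E i)) := by
  obtain ⟨A₁, A₂, rfl, hA₁, hA₂⟩ := hA.split haA
  obtain ⟨C₁, C₂, rfl, hC₁, hC₂⟩ := hC.split hbC
  have hT : M.IsWalk a (A₂ ++ B ++ C₁) b := (hA₂.append hB).append hC₁
  have hσ : M.IsShortest (M.tail (L j)) (A₁ ++ (A₂ ++ B ++ C₁) ++ C₂) (M.tail (E j)) := by
    simpa only [List.append_assoc] using hABC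
  have hTs := hσ.middle hA₁ hT hC₂
  obtain ⟨P₁, Z, P₂, rfl, ⟨h1, h2, h3⟩ | ⟨h1, h2, h3⟩⟩ := hP.1.exists_segment haP hbP
  · have hlen := hTs.length_eq (hP.middle h1 h2 h3)
    refine ⟨P₁ ++ A₂, C₁ ++ P₂, h1.append hA₂, hC₁.append h3, hP.of_length_le
      (((h1.append hA₂).append hB).append (hC₁.append h3)) ?_⟩
    simp only [List.length_append] at hlen ⊢
    omega
  · have hlen := hTs.revWalk.length_eq (hP.middle h1 h2 h3)
    rw [length_revWalk] at hlen
    -- If Z is empty, the two meeting points coincide and the order is harmless. Otherwise the paths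
    -- visit the points in opposite orders, which is to be refuted.
    obtain rfl | hZ := eq_or_ne Z []
    · obtain rfl := isWalk_nil.1 h2
      refine ⟨P₁ ++ A₂, C₁ ++ P₂, h1.append hA₂, hC₁.append h3, hP.of_length_le
        (((h1.append hA₂).append hB).append (hC₁.append h3)) ?_⟩
      simp only [List.length_append, List.length_nil] at hlen ⊢
      omega
    exfalso
    have hZ0 : 0 < Z.length := List.length_pos_of_ne_nil hZ
    generalize A₂ ++ B ++ C₁ = T at *
    -- Exchanging the final parts of the two paths produces walks that join opposite indices and
    -- therefore cross.
    have hcross : ∃ z ∈ M.support (M.tail (L i)) (P₁ ++ C₂),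
        z ∈ M.support (M.tail (L j)) (A₁ ++ P₂) := by
      rcases lt_or_gt_of_ne hij with h | h
      · exact hS.exists_crossing h (h1.append hC₂) (hA₁.append h3)
      · obtain ⟨z, hz, hz'⟩ := hS.exists_crossing h (hA₁.append h3) (h1.append hC₂)
        exact ⟨z, hz', hz⟩
    obtain ⟨z, hz, hz'⟩ := hcross
    rcases h1.mem_support_append.1 hz with hz | hz <;>
      rcases hA₁.mem_support_append.1 hz' with hz' | hz'
    -- If z precedes both points on both paths, then one path makes b strictly closer to z than a,
    -- and the other makes a strictly closer than b.
    · obtain ⟨P₃, P₄, rfl, h4, h5⟩ := h1.split hz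
      obtain ⟨A₃, A₄, rfl, h6, h7⟩ := hA₁.split hz'
      have e1 := ((hP.left (h1.append h2) h3).left h1 h2).right h4 h5
      have e2 := (IsShortest.right (A := P₃) (B := P₄ ++ Z)
        (by simpa using hP.left (h1.append h2) h3) h4 (h5.append h2))
      have e3 := ((hσ.left (hA₁.append hT) hC₂).left hA₁ hT).right h6 h7
      have e4 := (IsShortest.right (A := A₃) (B := A₄ ++ T)
        (by simpa using hσ.left (hA₁.append hT) hC₂) h6 (h7.append hT))
      have e5 := e1.length_eq e4
      have e6 := e2.length_eq e3
      simp only [List.length_append] at e5 e6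
      omega
    -- Here P visits z both before and after the nonempty segment Z.
    · obtain ⟨P₃, P₄, rfl, h4, h5⟩ := h1.split hz
      obtain ⟨P₅, P₆, rfl, h6, h7⟩ := h3.split hz'
      have e1 : M.IsShortest z (P₄ ++ Z ++ P₅) z := IsShortest.middle (A := P₃) (C := P₆)
        (by simpa using hP) h4 ((h5.append h2).append h6) h7
      have := e1.2 [] rfl
      simp only [List.length_append, List.length_nil] at this
      omega
    -- Here the path of index j visits z before and after T, which is as long as Z.
    · obtain ⟨C₃, C₄, rfl, h4, h5⟩ := hC₂.split hz
      obtain ⟨A₃, A₄, rfl, h6, h7⟩ := hA₁.split hz'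
      have e1 : M.IsShortest z (A₄ ++ T ++ C₃) z := IsShortest.middle (A := A₃) (C := C₄)
        (by simpa using hσ) h6 ((h7.append hT).append h4) h5
      have := e1.2 [] rfl
      simp only [List.length_append, List.length_nil] at this
      omega
    -- The mirror image of the first case: z follows both points on both paths.
    · obtain ⟨C₃, C₄, rfl, h4, h5⟩ := hC₂.split hz
      obtain ⟨P₅, P₆, rfl, h6, h7⟩ := h3.split hz'
      have e1 : M.IsShortest b (Z ++ P₅) z := IsShortest.middle (A := P₁) (C := P₆)
        (by simpa using hP) h1 (h2.append h6) h7
      have e2 : M.IsShortest a P₅ z := e1.right h2 h6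
      have e3 : M.IsShortest a (T ++ C₃) z := IsShortest.middle (A := A₁) (C := C₄)
        (by simpa using hσ) hA₁ (hT.append h4) h5
      have e4 : M.IsShortest b C₃ z := e3.right hT h4
      have e5 := e1.length_eq e4
      have e6 := e2.length_eq e3
      simp only [List.length_append] at e5 e6
      omega

/-- The shortest paths from `L j` to `E j`, compared with the first paths from `L i` to `E i` of the
visits by `rot` and by `rot⁻¹`. -/
theorem shortest_paths (hS : M.IsSlit L E) (i : Fin (k + 1)) :
    (∀ j, i < j → ∀ l, M.IsShortest (M.tail (L j)) l (M.tail (E j)) →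
      (M.induce (M.side M.rot⁻¹ (M.rot (L i)) (E i)
          (M.bfsPath M.rot⁻¹ (M.rot (L i)) (M.tail (E i)))) ∪
        M.induce (M.side M.rot⁻¹ (M.rot (L i)) (E i) (M.bfsPath M.rot (L i) (M.tail (E i))) ∩
          M.side M.rot (L i) (M.rot (E i))
            (M.bfsPath M.rot⁻¹ (M.rot (L i)) (M.tail (E i))))).IsWalk
        (M.tail (L j)) l (M.tail (E j))) ∧
    (∀ j u v A B C, M.IsWalk (M.tail (L j)) A u →
      (M.induce (M.side M.rot⁻¹ (M.rot (L i)) (E i) (M.bfsPath M.rot (L i) (M.tail (E i))) ∩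
          M.side M.rot (L i) (M.rot (E i))
            (M.bfsPath M.rot⁻¹ (M.rot (L i)) (M.tail (E i))))).IsWalk u B v →
      M.IsWalk v C (M.tail (E j)) →
      M.IsShortest (M.tail (L j)) (A ++ B ++ C) (M.tail (E j)) →
      ∃ A' C', M.IsWalk (M.tail (L i)) A' u ∧ M.IsWalk v C' (M.tail (E i)) ∧
        M.IsShortest (M.tail (L i)) (A' ++ B ++ C') (M.tail (E i))) := by
  have hl : M.IsShortest (M.tail (L i)) (M.bfsPath M.rot (L i) (M.tail (E i))) (M.tail (E i)) :=
    bfsPath_isShortest sameCycle_rot hS.connected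
  have hr : M.IsShortest (M.tail (L i)) (M.bfsPath M.rot⁻¹ (M.rot (L i)) (M.tail (E i)))
      (M.tail (E i)) := by
    have := bfsPath_isShortest (r := M.rot (L i)) (v := M.tail (E i)) sameCycle_rot_inv hS.connected
    rwa [tail_rot] at this
  have hsup : ∀ P, M.support (M.tail (M.rot (L i))) P = M.support (M.tail (L i)) P := by
    simp [tail_rot]
  generalize hπr : M.bfsPath M.rot⁻¹ (M.rot (L i)) (M.tail (E i)) = πr at *
  constructor
  · intro j hij l hlj
    have hpos := hS.mem_right_of_lt hl.1 hl.nodup_support (m := j)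
    have hR : ∀ w ∈ M.support (M.tail (L j)) l, w ∈ M.side M.rot⁻¹ (M.rot (L i)) (E i)
        (M.bfsPath M.rot (L i) (M.tail (E i))) := fun w hw =>
      hlj.mem_side_bfsPath hS.connected (hS.ne i i) (hpos.1 hij) (hpos.2 hij) hw
    have hor := mem_side_or hS.connected (hS.ne i i) hr.1 hr.nodup_support
    refine ⟨hlj.1, fun w hw => ?_, fun d hd => ?_⟩
    · rcases hor w with h | h
      · exact Or.inr ⟨hR w hw, h⟩
      · exact Or.inl h
    -- A union of induced subgraphs could miss edges between its parts. But if one end of an edge is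
    -- not on the second side of πr, then the edge leaves a vertex off πr on the first side, so both
    -- of its ends lie on that side.
    · have ht := hR _ (hlj.1.tail_mem_support hd)
      have hh := hR _ (head_mem_support hd)
      by_cases h1 : M.tail d ∈ M.side M.rot⁻¹ (M.rot (L i)) (E i) πr
      · by_cases h2 : M.head d ∈ M.side M.rot⁻¹ (M.rot (L i)) (E i) πr
        · exact Or.inl ⟨h1, h2⟩
        · have h3 := (hor _).resolve_right h2
          refine Or.inr ⟨⟨ht, tail_mem_side_of_head_mem h3 fun hc => h2 ?_⟩, hh, h3⟩
          exact support_subset_side (by rwa [hsup])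
      · have h3 := (hor _).resolve_right h1
        refine Or.inr ⟨⟨ht, h3⟩, hh, head_mem_side_of_tail_mem h3 fun hc => h1 ?_⟩
        exact support_subset_side (by rwa [hsup])
  · intro j u v A B C hA hB hC hABC
    rw [mem_induce_isWalk] at hB
    obtain ⟨hB, hBS⟩ := hB
    obtain ⟨hur, hul⟩ := hBS u (start_mem_support _ _)
    obtain ⟨hvr, hvl⟩ := hBS v hB.end_mem_support
    -- The path to compare with is the one that separates the middle part from the ends of index j:
    -- πr for larger j, the first path of the visit by `rot` for smaller j.
    rcases lt_trichotomy i j with hij | rfl | hij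
    · have hpos := hS.mem_right_of_lt hr.1 hr.nodup_support (m := j)
      obtain ⟨a, haA, haP⟩ :=
        hS.exists_mem_support hr.1 hr.nodup_support hA.revWalk hul (hpos.1 hij)
      obtain ⟨b, hbC, hbP⟩ := hS.exists_mem_support hr.1 hr.nodup_support hC hvl (hpos.2 hij)
      exact hS.exists_shortest_through hij.ne hr hA hB hC hABC (hA.mem_support_revWalk.1 haA) haP
        hbC hbP
    · exact ⟨A, C, hA, hC, hABC⟩
    · have hpos := hS.mem_left_of_le hl.1 hl.nodup_support (m := j)
      obtain ⟨a, haA, haP⟩ :=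
        hS.exists_mem_support hl.1 hl.nodup_support hA (hpos.1 hij.le) hur
      obtain ⟨b, hbC, hbP⟩ := hS.exists_mem_support hl.1 hl.nodup_support hC.revWalk
        (hpos.2 hij.le) hvr
      exact hS.exists_shortest_through hij.ne' hl hA hB hC hABC haA haP
        (hC.mem_support_revWalk.1 hbC) hbP

end IsSlit

end CombMap

/-! ### The dual of a plane map -/

namespace CombMap

variable {D : Type*}

theorem rot_face (M : CombMap D) (d : D) : M.rot (M.face d) = M.rev d := by simp [face]

theorem face_eq_iff {M : CombMap D} {d e : D} : M.face d = e ↔ M.rot e = M.rev d := by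
  rw [← rot_face, M.rot.injective.eq_iff, eq_comm]

/-- Converse of `Connected.apply_eq`. Connectivity becomes a statement on invariant functions of the
darts, which transfers easily to the dual and to the cut map. -/
theorem connected_of_apply_eq {M : CombMap D}
    (h : ∀ φ : D → Prop, (∀ d, φ (M.rot d) = φ d) → (∀ d, φ (M.rev d) = φ d) → ∀ a b, φ a = φ b) :
    M.Connected := by
  intro u v
  obtain ⟨a, rfl⟩ := tail_surjective u
  obtain ⟨b, rfl⟩ := tail_surjective v
  have hrev : ∀ d, (∃ l, M.IsWalk (M.tail a) l (M.tail d)) →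
      ∃ l, M.IsWalk (M.tail a) l (M.tail (M.rev d)) := by
    rintro d ⟨l, hl⟩
    exact ⟨l ++ [d], hl.append (isWalk_singleton.2 ⟨rfl, rfl⟩)⟩
  have := h (fun d => ∃ l, M.IsWalk (M.tail a) l (M.tail d)) (fun d => by simp only [tail_rot])
    (fun d => propext ⟨fun hd => by simpa only [M.rev_rev] using hrev _ hd, hrev d⟩) a b
  exact this ▸ ⟨[], rfl⟩

theorem Connected.dual {M : CombMap D} (hM : M.Connected) : M.dual.Connected := by
  refine connected_of_apply_eq fun φ hrot hrev => hM.apply_eq (fun d => ?_) hrev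
  have h : ∀ e, φ (M.face e) = φ e := hrot
  conv_rhs => rw [← Equiv.apply_symm_apply M.face d, h, ← hrev]
  conv_lhs => rw [← Equiv.apply_symm_apply M.face d, rot_face]
  rfl

/-- A face of the dual is a vertex of the original map, namely the common head of its darts. -/
theorem head_dual_face (M : CombMap D) (d : D) : M.head (M.dual.face d) = M.head d := by
  have h : M.face (M.dual.face d) = M.rev d := rot_face M.dual d
  rw [← tail_face, h, tail_rev]

theorem head_dual_rot_inv (M : CombMap D) (d : D) : M.head (M.dual.rot⁻¹ d) = M.tail d := by
  rw [← tail_face]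
  exact congrArg M.tail (Equiv.apply_symm_apply M.face d)

theorem IsPlane.dual_euler [Finite D] {M : CombMap D} (hM : M.IsPlane) :
    Nat.card M.dual.Edge + 2 ≤ Nat.card M.dual.Vert + Nat.card M.dual.Face := by
  have h1 : Nat.card M.Vert ≤ Nat.card M.dual.Face := by
    refine Nat.card_le_card_of_surjective (Quotient.lift M.head fun a b h =>
      apply_eq_of_sameCycle (ρ := M.dual.face) (head_dual_face M) h) fun v => ?_
    obtain ⟨d, rfl⟩ := tail_surjective v
    exact ⟨M.dual.faceOf (M.rev d), head_rev d⟩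
  have h2 := hM.2
  change Nat.card M.Edge + 2 ≤ Nat.card M.Face + Nat.card M.dual.Face
  omega

/-! ### The cut map -/

/-- The transpositions are disjoint, so each of them acts alone. -/
theorem prod_swap_apply {α : Type*} [DecidableEq α] {n : ℕ} {a b : Fin n → α}
    (ha : Function.Injective a) (hb : Function.Injective b) (hab : ∀ i j, a i ≠ b j) :
    (∀ i, (List.ofFn fun i => Equiv.swap (a i) (b i)).prod (a i) = b i) ∧
      (∀ i, (List.ofFn fun i => Equiv.swap (a i) (b i)).prod (b i) = a i) ∧
      ∀ z, (∀ i, z ≠ a i) → (∀ i, z ≠ b i) →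
        (List.ofFn fun i => Equiv.swap (a i) (b i)).prod z = z := by
  induction n with
  | zero => exact ⟨fun i => i.elim0, fun i => i.elim0, fun z _ _ => by simp⟩
  | succ n ih =>
    obtain ⟨h1, h2, h3⟩ := ih (a := fun i => a i.succ) (b := fun i => b i.succ)
      (fun i j h => Fin.succ_injective _ (ha h)) (fun i j h => Fin.succ_injective _ (hb h))
      (fun i j => hab _ _)
    simp only [List.ofFn_succ, List.prod_cons, Equiv.Perm.mul_apply]
    refine ⟨fun i => ?_, fun i => ?_, fun z hz hz' => ?_⟩
    · cases i using Fin.cases with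
      | zero =>
        rw [h3 (a 0) (fun i h => (Fin.succ_ne_zero i) (ha h).symm) (fun i => hab _ _),
          Equiv.swap_apply_left]
      | succ i =>
        rw [h1 i, Equiv.swap_apply_of_ne_of_ne (hab _ _).symm
          fun h => (Fin.succ_ne_zero i) (hb h)]
    · cases i using Fin.cases with
      | zero =>
        rw [h3 (b 0) (fun i => (hab _ _).symm) (fun i h => (Fin.succ_ne_zero i) (hb h).symm),
          Equiv.swap_apply_right]
      | succ i =>
        rw [h2 i, Equiv.swap_apply_of_ne_of_ne (fun h => (Fin.succ_ne_zero i) (ha h)) (hab _ _)]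
    · rw [h3 z (fun i => hz _) (fun i => hz' _), Equiv.swap_apply_of_ne_of_ne (hz _) (hz' _)]

section Cut

variable {H : CombMap D} {p : List D} {ds dt : D}

theorem exchange_inl_of_mem {S : Set D} {d : D} (h : d ∈ p ∨ H.rev d ∈ p) (hS : d ∈ S) :
    H.exchange p S (Sum.inl d) = Sum.inr ⟨d, h⟩ := dif_pos (And.intro h hS)

theorem exchange_inl_of_not {S : Set D} {d : D} (h : ¬((d ∈ p ∨ H.rev d ∈ p) ∧ d ∈ S)) :
    H.exchange p S (Sum.inl d) = Sum.inl d := dif_neg h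

theorem exchange_inl_of_notMem {S : Set D} {d : D} (hS : d ∉ S) :
    H.exchange p S (Sum.inl d) = Sum.inl d := exchange_inl_of_not fun h => hS h.2

theorem exchange_inr_of_mem {S : Set D} {d : H.PathDart p} (hS : d.1 ∈ S) :
    H.exchange p S (Sum.inr d) = Sum.inl d.1 := if_pos hS

theorem exchange_inr_of_notMem {S : Set D} {d : H.PathDart p} (hS : d.1 ∉ S) :
    H.exchange p S (Sum.inr d) = Sum.inr d := if_neg hS

/-- The copy of the dart `d` in the cut map that has the face of `d` on its left. -/
noncomputable def cutLift (H : CombMap D) (p : List D) (d : D) : H.CutDart p :=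
  H.exchange p {d | H.rev d ∈ p} (Sum.inl d)

/-- The copy of the dart `d` in the cut map that has the face of `rev d` on its right. -/
noncomputable def cutLift' (H : CombMap D) (p : List D) (d : D) : H.CutDart p :=
  H.exchange p {d | d ∈ p} (Sum.inl d)

theorem cutLift_injective : Function.Injective (H.cutLift p) := fun _ _ h =>
  Sum.inl_injective ((H.exchange p _).injective h)

/-- The corners of the original map survive the doubling of edges, each between these two lifts. -/
theorem doubledRot_cutLift (d : D) :
    H.doubledRot p (H.cutLift p d) = H.cutLift' p (H.rot d) := by
  have : H.exchange p {d | H.rev d ∈ p} (H.cutLift p d) = Sum.inl d := by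
    rw [cutLift]
    by_cases h : H.rev d ∈ p
    · rw [exchange_inl_of_mem (Or.inr h) h, exchange_inr_of_mem h]
    · rw [exchange_inl_of_notMem (S := {d | H.rev d ∈ p}) h,
        exchange_inl_of_notMem (S := {d | H.rev d ∈ p}) h]
  simp only [doubledRot, Equiv.Perm.mul_apply, this]
  rfl

theorem cut_rev_cutLift (d : D) :
    (H.cut p ds dt).rev (H.cutLift p d) = H.cutLift' p (H.rev d) := by
  rw [cutLift, cutLift']
  by_cases h : H.rev d ∈ p
  · rw [exchange_inl_of_mem (Or.inr h) h, exchange_inl_of_mem (Or.inl h) h]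
    rfl
  · rw [exchange_inl_of_notMem (S := {d | H.rev d ∈ p}) h,
      exchange_inl_of_notMem (S := {d | d ∈ p}) h]
    rfl

/-- The dart of the original map from which a dart of the cut map comes. -/
def cutProj (H : CombMap D) (p : List D) : H.CutDart p → D := Sum.elim id Subtype.val

theorem cutProj_exchange (S : Set D) (z : H.CutDart p) :
    H.cutProj p (H.exchange p S z) = H.cutProj p z := by
  rcases z with d | d
  · by_cases h : (d ∈ p ∨ H.rev d ∈ p) ∧ d ∈ S
    · rw [exchange_inl_of_mem h.1 h.2]; rfl
    · rw [exchange_inl_of_not h]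
  · by_cases h : d.1 ∈ S
    · rw [exchange_inr_of_mem h]; rfl
    · rw [exchange_inr_of_notMem h]

theorem tail_cutProj_doubledRot (z : H.CutDart p) :
    H.tail (H.cutProj p (H.doubledRot p z)) = H.tail (H.cutProj p z) := by
  simp only [doubledRot, Equiv.Perm.mul_apply, cutProj_exchange]
  rw [← cutProj_exchange {d | H.rev d ∈ p} z]
  rcases H.exchange p {d | H.rev d ∈ p} z with d | d
  · exact tail_rot d
  · rfl

theorem enter_zero : H.enter p ds 0 = H.cutLift p (H.rot⁻¹ ds) := rfl

theorem enter_succ (m : Fin p.length) : H.enter p ds m.succ = Sum.inl (H.rev (p.get m)) := rfl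

theorem leave_last : H.leave p dt (Fin.last _) = H.cutLift p (H.rot⁻¹ dt) := by
  simp [leave, cutLift]

theorem leave_castSucc (m : Fin p.length) :
    H.leave p dt m.castSucc = Sum.inr ⟨p.get m, Or.inl (List.get_mem p m)⟩ := by
  simp [leave]

theorem tail_cutProj_enter (i : Fin (p.length + 1)) :
    H.tail (H.cutProj p (H.enter p ds i)) = (H.support (H.tail ds) p)[i.1]'(by
      simpa [support] using Nat.lt_succ_iff.1 i.2) := by
  cases i using Fin.cases with
  | zero => rw [enter_zero, cutLift, cutProj_exchange]; exact tail_rot_inv ds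
  | succ m => simp [enter_succ, cutProj, support, tail_rev]

theorem IsWalk.tail_get {u v : H.Vert} {l : List D} (h : H.IsWalk u l v) (m : ℕ)
    (hm : m < l.length) : H.tail l[m] = (H.support u l)[m]'(by simp [support]; omega) := by
  induction l generalizing u m with
  | nil => simp at hm
  | cons d l ih =>
    cases m with
    | zero => simp [h.1]
    | succ m => simpa using ih h.2 m (by simpa using hm)

theorem IsWalk.end_eq {u v : H.Vert} {l : List D} (h : H.IsWalk u l v) :
    v = (H.support u l)[l.length]'(by simp [support]) := by
  induction l generalizing u with
  | nil => simp [isWalk_nil.1 h]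
  | cons d l ih => simpa using ih h.2

/-- A walk with distinct vertices along which a map can be cut. -/
structure IsCutPath (H : CombMap D) (p : List D) (ds dt : D) : Prop where
  walk : H.IsWalk (H.tail ds) p (H.tail dt)
  nodup : (H.support (H.tail ds) p).Nodup
  faceOf_ne : H.faceOf (H.rot⁻¹ ds) ≠ H.faceOf (H.rot⁻¹ dt)

/-! ### Rotation, faces and connectivity of the cut map -/

namespace IsCutPath

theorem tail_cutProj_leave (h : H.IsCutPath p ds dt) (i : Fin (p.length + 1)) :
    H.tail (H.cutProj p (H.leave p dt i)) = H.tail (H.cutProj p (H.enter p ds i)) := by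
  rw [tail_cutProj_enter]
  cases i using Fin.lastCases with
  | last =>
    rw [leave_last, cutLift, cutProj_exchange]
    exact (tail_rot_inv dt).trans h.walk.end_eq
  | cast m => rw [leave_castSucc]; exact h.walk.tail_get m m.2

theorem tail_injective (h : H.IsCutPath p ds dt) {i j : Fin (p.length + 1)}
    (hij : H.tail (H.cutProj p (H.enter p ds i)) = H.tail (H.cutProj p (H.enter p ds j))) :
    i = j := by
  rw [tail_cutProj_enter, tail_cutProj_enter] at hij
  exact Fin.ext ((List.Nodup.getElem_inj_iff h.nodup).1 hij)

theorem enter_injective (h : H.IsCutPath p ds dt) : Function.Injective (H.enter p ds) :=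
  fun _ _ hij => h.tail_injective (by rw [hij])

theorem leave_injective (h : H.IsCutPath p ds dt) : Function.Injective (H.leave p dt) :=
  fun i j hij => h.tail_injective (by rw [← h.tail_cutProj_leave, ← h.tail_cutProj_leave, hij])

theorem cutLift_of_mem (h : H.IsCutPath p ds dt) {d : D} (hd : d ∈ p) :
    H.cutLift p d = Sum.inl d :=
  exchange_inl_of_notMem (h.walk.rev_notMem h.nodup hd)

/-- Among the corners through which the cut enters, only the first is a corner of the original map;
the others lie between the two copies of an edge. -/
theorem cutLift_eq_enter {d : D} {i : Fin (p.length + 1)}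
    (hd : H.cutLift p d = H.enter p ds i) : i = 0 ∧ d = H.rot⁻¹ ds := by
  cases i using Fin.cases with
  | zero => exact ⟨rfl, cutLift_injective hd⟩
  | succ m =>
    exfalso
    have hp := congrArg (H.cutProj p) hd
    rw [cutLift, cutProj_exchange] at hp
    have hp : d = H.rev (p.get m) := hp
    have hm : H.rev d ∈ p := by rw [hp, H.rev_rev]; exact List.get_mem p m
    rw [cutLift, exchange_inl_of_mem (Or.inr hm) hm, enter_succ] at hd
    exact Sum.inr_ne_inl hd

theorem cutLift_eq_leave (h : H.IsCutPath p ds dt) {d : D} {i : Fin (p.length + 1)}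
    (hd : H.cutLift p d = H.leave p dt i) : i = Fin.last _ ∧ d = H.rot⁻¹ dt := by
  cases i using Fin.lastCases with
  | last => exact ⟨rfl, cutLift_injective (hd.trans leave_last)⟩
  | cast m =>
    exfalso
    rw [leave_castSucc] at hd
    have hp := congrArg (H.cutProj p) hd
    rw [cutLift, cutProj_exchange] at hp
    have hp : d = p.get m := hp
    rw [h.cutLift_of_mem (hp ▸ List.get_mem p m)] at hd
    exact Sum.inl_ne_inr hd

/-- The only possible coincidence is between the first and the last corner of the cut, and these
belong to different faces. -/
theorem leave_ne_enter (h : H.IsCutPath p ds dt) (i j : Fin (p.length + 1)) :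
    H.leave p dt i ≠ H.enter p ds j := by
  intro hij
  cases i using Fin.lastCases with
  | last =>
    rw [leave_last] at hij
    have := (cutLift_eq_enter hij).2
    exact h.faceOf_ne (by rw [this])
  | cast m =>
    cases j using Fin.cases with
    | zero =>
      rw [enter_zero] at hij
      have := h.cutLift_eq_leave hij.symm
      exact absurd this.1 (Fin.castSucc_lt_last m).ne
    | succ m' =>
      rw [leave_castSucc, enter_succ] at hij
      exact Sum.inr_ne_inl hij

theorem cut_rot_enter (h : H.IsCutPath p ds dt) (i : Fin (p.length + 1)) :
    (H.cut p ds dt).rot (H.enter p ds i) = H.doubledRot p (H.leave p dt i) := by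
  classical
  have := (prod_swap_apply h.enter_injective h.leave_injective
    fun i j => (h.leave_ne_enter j i).symm).1 i
  simp only [cut, Equiv.Perm.mul_apply]
  convert congrArg (H.doubledRot p) this

theorem cut_rot_leave (h : H.IsCutPath p ds dt) (i : Fin (p.length + 1)) :
    (H.cut p ds dt).rot (H.leave p dt i) = H.doubledRot p (H.enter p ds i) := by
  classical
  have := (prod_swap_apply h.enter_injective h.leave_injective
    fun i j => (h.leave_ne_enter j i).symm).2.1 i
  simp only [cut, Equiv.Perm.mul_apply]
  convert congrArg (H.doubledRot p) this

theorem cut_rot_of_ne (h : H.IsCutPath p ds dt) {z : H.CutDart p} (hz : ∀ i, z ≠ H.enter p ds i)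
    (hz' : ∀ i, z ≠ H.leave p dt i) : (H.cut p ds dt).rot z = H.doubledRot p z := by
  classical
  have := (prod_swap_apply h.enter_injective h.leave_injective
    fun i j => (h.leave_ne_enter j i).symm).2.2 z hz hz'
  simp only [cut, Equiv.Perm.mul_apply]
  convert congrArg (H.doubledRot p) this

theorem doubledRot_inr (h : H.IsCutPath p ds dt) {d : D} (hd : d ∈ p) :
    H.doubledRot p (Sum.inr ⟨d, Or.inl hd⟩) = Sum.inl d := by
  simp only [doubledRot, Equiv.Perm.mul_apply]
  rw [exchange_inr_of_notMem (h.walk.rev_notMem h.nodup hd)]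
  exact exchange_inr_of_mem (S := {d | d ∈ p}) hd

theorem doubledRot_inl (h : H.IsCutPath p ds dt) {d : D} (hd : H.rev d ∈ p) :
    H.doubledRot p (Sum.inl d) = Sum.inr ⟨d, Or.inr hd⟩ := by
  simp only [doubledRot, Equiv.Perm.mul_apply]
  rw [exchange_inl_of_mem (Or.inr hd) hd]
  refine exchange_inr_of_notMem (S := {d | d ∈ p}) fun hd' => ?_
  exact h.walk.rev_notMem h.nodup hd' hd

/-- The splits at the ends of an edge of p open the digon between its two copies, so that the right
copies follow one another along the outer face. -/
theorem cut_face_leave (h : H.IsCutPath p ds dt) (m : Fin p.length) :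
    (H.cut p ds dt).face (H.leave p dt m.castSucc) = H.leave p dt m.succ := by
  rw [face_eq_iff, h.cut_rot_leave, leave_castSucc, enter_succ, h.doubledRot_inl]
  · rfl
  · rw [H.rev_rev]; exact List.get_mem p m

theorem cut_face_enter (h : H.IsCutPath p ds dt) (m : Fin p.length) :
    (H.cut p ds dt).face (H.enter p ds m.succ) = H.enter p ds m.castSucc := by
  rw [face_eq_iff, h.cut_rot_enter, leave_castSucc, enter_succ,
    h.doubledRot_inr (List.get_mem p m)]
  simp [cut, H.rev_rev]

theorem cut_face_cutLift (h : H.IsCutPath p ds dt) {d : D} (hs : H.face d ≠ H.rot⁻¹ ds)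
    (ht : H.face d ≠ H.rot⁻¹ dt) :
    (H.cut p ds dt).face (H.cutLift p d) = H.cutLift p (H.face d) := by
  rw [face_eq_iff, h.cut_rot_of_ne, doubledRot_cutLift, rot_face, cut_rev_cutLift]
  · exact fun i hi => hs (cutLift_eq_enter hi).2
  · exact fun i hi => ht (h.cutLift_eq_leave hi).2

theorem cut_face_cutLift_last (h : H.IsCutPath p ds dt) {d : D} (ht : H.face d = H.rot⁻¹ dt) :
    (H.cut p ds dt).face (H.cutLift p d) = H.enter p ds (Fin.last _) := by
  rw [face_eq_iff, h.cut_rot_enter, leave_last, ← ht, doubledRot_cutLift, rot_face,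
    cut_rev_cutLift]

theorem sameCycle_last [Finite D] (h : H.IsCutPath p ds dt) :
    (H.cut p ds dt).face.SameCycle (H.leave p dt (Fin.last _)) (H.enter p ds (Fin.last _)) := by
  obtain ⟨T, hT0, hT, hmin⟩ := exists_period H.face (H.rot⁻¹ dt)
  have hface : ∀ m, H.faceOf ((H.face ^ m) (H.rot⁻¹ dt)) = H.faceOf (H.rot⁻¹ dt) := by
    intro m
    induction m with
    | zero => rfl
    | succ m ih => rw [pow_succ', Equiv.Perm.mul_apply, faceOf_face, ih]
  -- The boundary of the face at dt is copied unchanged until it returns to the corner of the cut: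
  -- the corner at ds lies on another face, and the corner at dt is met again only after the full
  -- period T. The last step then crosses over to the left copy.
  have hpow : ∀ m < T, ((H.cut p ds dt).face ^ m) (H.cutLift p (H.rot⁻¹ dt)) =
      H.cutLift p ((H.face ^ m) (H.rot⁻¹ dt)) := by
    intro m
    induction m with
    | zero => intro; rfl
    | succ m ih =>
      intro hm
      have hsucc : H.face ((H.face ^ m) (H.rot⁻¹ dt)) = (H.face ^ (m + 1)) (H.rot⁻¹ dt) := by
        rw [pow_succ', Equiv.Perm.mul_apply]
      rw [pow_succ', Equiv.Perm.mul_apply, ih (by omega), h.cut_face_cutLift, hsucc]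
      · rw [hsucc]
        intro hc
        exact h.faceOf_ne (by rw [← hc, hface])
      · rw [hsucc]
        exact hmin _ (by omega) hm
  refine ⟨(T : ℕ), ?_⟩
  obtain ⟨m, rfl⟩ : ∃ m, T = m + 1 := ⟨T - 1, by omega⟩
  rw [zpow_natCast, pow_succ', Equiv.Perm.mul_apply, leave_last, hpow m (by omega)]
  exact h.cut_face_cutLift_last (by rw [← Equiv.Perm.mul_apply, ← pow_succ', hT])

theorem sameCycle [Finite D] (h : H.IsCutPath p ds dt) (i j : Fin (p.length + 1)) :
    (H.cut p ds dt).face.SameCycle (H.leave p dt i) (H.enter p ds j) := by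
  rw [← faceOf_eq_faceOf]
  have h1 : ∀ i, (H.cut p ds dt).faceOf (H.leave p dt i) =
      (H.cut p ds dt).faceOf (H.leave p dt 0) := by
    intro i
    induction i using Fin.induction with
    | zero => rfl
    | succ m ih => rw [← h.cut_face_leave, faceOf_face, ih]
  have h2 : ∀ i, (H.cut p ds dt).faceOf (H.enter p ds i) =
      (H.cut p ds dt).faceOf (H.enter p ds 0) := by
    intro i
    induction i using Fin.induction with
    | zero => rfl
    | succ m ih => rw [← faceOf_face, h.cut_face_enter, ih]
  rw [h1, h2, ← h1 (Fin.last _), ← h2 (Fin.last _), faceOf_eq_faceOf]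
  exact h.sameCycle_last

/-- A function of the darts that is invariant under the doubled rotation comes from a function that is
invariant under the original one. -/
theorem apply_eq_of_doubledRot (h : H.IsCutPath p ds dt) {α : Type*} {φ : H.CutDart p → α}
    (hφ : ∀ z, φ (H.doubledRot p z) = φ z) :
    (∀ z, φ z = φ (Sum.inl (H.cutProj p z))) ∧ ∀ d, φ (Sum.inl (H.rot d)) = φ (Sum.inl d) := by
  have h1 : ∀ z, φ z = φ (Sum.inl (H.cutProj p z)) := by
    rintro (d | ⟨d, hd | hd⟩)
    · rfl
    · rw [← hφ, h.doubledRot_inr hd]; rfl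
    · change _ = φ (Sum.inl d)
      rw [← hφ (Sum.inl d), h.doubledRot_inl hd]
  refine ⟨h1, fun d => ?_⟩
  have h2 := hφ (H.cutLift p d)
  rw [doubledRot_cutLift, h1, h1 (H.cutLift p d), cutLift, cutLift', cutProj_exchange,
    cutProj_exchange] at h2
  exact h2

theorem sameCycle_doubledRot (h : H.IsCutPath p ds dt) {z z' : H.CutDart p}
    (hz : H.tail (H.cutProj p z) = H.tail (H.cutProj p z')) :
    (H.doubledRot p).SameCycle z z' := by
  let φ : H.CutDart p → Quotient (Equiv.Perm.SameCycle.setoid (H.doubledRot p)) := Quotient.mk _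
  have hφ : ∀ z, φ (H.doubledRot p z) = φ z := fun z =>
    Quotient.sound (Equiv.Perm.sameCycle_apply_left.2 (Equiv.Perm.SameCycle.refl _ _))
  obtain ⟨h1, h2⟩ := h.apply_eq_of_doubledRot hφ
  have : φ z = φ z' := by
    rw [h1 z, h1 z']
    exact apply_eq_of_sameCycle (φ := fun d => φ (Sum.inl d)) h2 (tail_eq_tail.1 hz)
  exact Quotient.exact this

/-- An invariant function is constant on the outer face, so it takes equal values at `leave i` and
`enter i`; undoing the splits keeps it invariant, and it descends to the original map. -/
theorem cut_connected [Finite D] (h : H.IsCutPath p ds dt) (hH : H.Connected) :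
    (H.cut p ds dt).Connected := by
  refine connected_of_apply_eq fun φ hrot hrev => ?_
  have hface : ∀ z, φ ((H.cut p ds dt).face z) = φ z := fun z => by
    rw [← hrot, rot_face, hrev]
  have hLE : ∀ i, φ (H.leave p dt i) = φ (H.enter p ds i) := fun i =>
    apply_eq_of_sameCycle hface (h.sameCycle i i)
  have hφ : ∀ z, φ (H.doubledRot p z) = φ z := by
    intro z
    by_cases hz : ∃ i, z = H.enter p ds i
    · obtain ⟨i, rfl⟩ := hz
      rw [← h.cut_rot_leave, hrot, hLE]
    by_cases hz' : ∃ i, z = H.leave p dt i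
    · obtain ⟨i, rfl⟩ := hz'
      rw [← h.cut_rot_enter, hrot, hLE]
    push Not at hz hz'
    rw [← h.cut_rot_of_ne hz hz', hrot]
  obtain ⟨h1, h2⟩ := h.apply_eq_of_doubledRot hφ
  intro a b
  rw [h1 a, h1 b]
  exact hH.apply_eq (φ := fun d => φ (Sum.inl d)) h2 (fun d => hrev (Sum.inl d)) _ _

theorem tail_cutProj_cut_rot (h : H.IsCutPath p ds dt) (z : H.CutDart p) :
    H.tail (H.cutProj p ((H.cut p ds dt).rot z)) = H.tail (H.cutProj p z) := by
  by_cases hz : ∃ i, z = H.enter p ds i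
  · obtain ⟨i, rfl⟩ := hz
    rw [h.cut_rot_enter, tail_cutProj_doubledRot, h.tail_cutProj_leave]
  by_cases hz' : ∃ i, z = H.leave p dt i
  · obtain ⟨i, rfl⟩ := hz'
    rw [h.cut_rot_leave, tail_cutProj_doubledRot, h.tail_cutProj_leave]
  push Not at hz hz'
  rw [h.cut_rot_of_ne hz hz', tail_cutProj_doubledRot]

end IsCutPath

/-- The darts at the right copies of the vertices of the path. -/
def rightCopy (H : CombMap D) (p : List D) (ds dt : D) : Set (H.CutDart p) :=
  {z | ∃ i, z ∈ arc (H.doubledRot p) (H.enter p ds i) (H.doubledRot p (H.leave p dt i))}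

theorem mem_of_sameCycle [Finite D] {ρ : Equiv.Perm D} {S : Set D} (hS : ∀ d ∈ S, ρ d ∈ S)
    {a b : D} (h : ρ.SameCycle a b) (ha : a ∈ S) : b ∈ S := by
  obtain ⟨n, rfl⟩ := h.exists_nat_pow_eq
  induction n with
  | zero => exact ha
  | succ n ih =>
    rw [pow_succ', Equiv.Perm.mul_apply]
    exact hS _ (ih ⟨n, by simp⟩)

/-! ### Euler's inequality for the cut map -/

namespace IsCutPath

theorem tail_of_mem_arc {i : Fin (p.length + 1)} {z o : H.CutDart p}
    (hz : z ∈ arc (H.doubledRot p) (H.enter p ds i) o) :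
    H.tail (H.cutProj p z) = H.tail (H.cutProj p (H.enter p ds i)) :=
  (apply_eq_of_sameCycle (φ := fun z => H.tail (H.cutProj p z)) tail_cutProj_doubledRot
    (sameCycle_of_mem_arc hz)).symm

theorem sameCycle_arc (h : H.IsCutPath p ds dt) (i : Fin (p.length + 1)) :
    (H.doubledRot p).SameCycle (H.enter p ds i) (H.doubledRot p (H.leave p dt i)) :=
  h.sameCycle_doubledRot (by rw [tail_cutProj_doubledRot, h.tail_cutProj_leave])

theorem leave_mem_rightCopy [Finite D] (h : H.IsCutPath p ds dt) (i : Fin (p.length + 1)) :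
    H.leave p dt i ∈ H.rightCopy p ds dt :=
  ⟨i, ((apply_mem_arc_or_eq (h.sameCycle_arc i)).1 (Or.inr rfl)).resolve_left
    (h.leave_ne_enter i i)⟩

theorem enter_notMem_rightCopy (h : H.IsCutPath p ds dt) (i : Fin (p.length + 1)) :
    H.enter p ds i ∉ H.rightCopy p ds dt := by
  rintro ⟨j, hj⟩
  obtain rfl := h.tail_injective (tail_of_mem_arc hj)
  exact self_notMem_arc hj

variable [Finite D]

theorem cut_rot_mem_rightCopy (h : H.IsCutPath p ds dt) {z : H.CutDart p}
    (hz : z ∈ H.rightCopy p ds dt) : (H.cut p ds dt).rot z ∈ H.rightCopy p ds dt := by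
  have hne : ∀ i, z ≠ H.enter p ds i := fun i hi => h.enter_notMem_rightCopy i (hi ▸ hz)
  obtain ⟨i, hi⟩ := hz
  refine ⟨i, ?_⟩
  by_cases hL : ∃ j, z = H.leave p dt j
  · obtain ⟨j, rfl⟩ := hL
    obtain rfl := h.tail_injective ((h.tail_cutProj_leave j).symm.trans (tail_of_mem_arc hi))
    rw [h.cut_rot_leave]
    exact ((apply_mem_arc_or_eq (h.sameCycle_arc j)).2 (Or.inl rfl)).resolve_right
      fun hc => h.leave_ne_enter j j ((H.doubledRot p).injective hc).symm
  · push Not at hL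
    rw [h.cut_rot_of_ne hne hL]
    exact ((apply_mem_arc_or_eq (h.sameCycle_arc i)).2 (Or.inr hi)).resolve_right
      fun hc => hL i ((H.doubledRot p).injective hc)

/-- `rightCopy` is closed under the rotation of the cut map. Each old vertex keeps a representative
dart outside of it, and the x_i, which lie inside, are new. -/
theorem card_vert (h : H.IsCutPath p ds dt) :
    Nat.card H.Vert + (p.length + 1) ≤ Nat.card (H.cut p ds dt).Vert := by
  have hex : ∀ v : H.Vert, ∃ z : H.CutDart p, H.tail (H.cutProj p z) = v ∧
      z ∉ H.rightCopy p ds dt := by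
    intro v
    by_cases hv : ∃ i, H.tail (H.cutProj p (H.enter p ds i)) = v
    · obtain ⟨i, hi⟩ := hv
      exact ⟨_, hi, h.enter_notMem_rightCopy i⟩
    · obtain ⟨d, rfl⟩ := tail_surjective v
      refine ⟨Sum.inl d, rfl, ?_⟩
      rintro ⟨i, hi⟩
      exact hv ⟨i, (tail_of_mem_arc hi).symm⟩
  choose f hf hfX using hex
  have htail : ∀ {z z'}, (H.cut p ds dt).tail z = (H.cut p ds dt).tail z' →
      H.tail (H.cutProj p z) = H.tail (H.cutProj p z') := fun hz =>
    apply_eq_of_sameCycle (φ := fun z => H.tail (H.cutProj p z)) h.tail_cutProj_cut_rot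
      (tail_eq_tail.1 hz)
  have hX : ∀ {z z'}, (H.cut p ds dt).tail z = (H.cut p ds dt).tail z' →
      z ∈ H.rightCopy p ds dt → z' ∈ H.rightCopy p ds dt := fun hz =>
    mem_of_sameCycle (fun _ => h.cut_rot_mem_rightCopy) (tail_eq_tail.1 hz)
  have hinj : Function.Injective (Sum.elim (fun v => (H.cut p ds dt).tail (f v))
      fun i => (H.cut p ds dt).tail (H.leave p dt i)) := by
    rintro (v | i) (w | j) hvw
    · have := htail hvw
      rw [hf, hf] at this
      rw [this]
    · exact absurd (hX hvw.symm (h.leave_mem_rightCopy j)) (hfX v)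
    · exact absurd (hX hvw (h.leave_mem_rightCopy i)) (hfX w)
    · have := htail hvw
      rw [h.tail_cutProj_leave, h.tail_cutProj_leave] at this
      rw [h.tail_injective this]
  have := Nat.card_le_card_of_injective _ hinj
  rwa [Nat.card_sum, Nat.card_fin] at this

theorem exists_cutLift_of_sameCycle (h : H.IsCutPath p ds dt) {d : D} {z : H.CutDart p}
    (hs : H.faceOf d ≠ H.faceOf (H.rot⁻¹ ds)) (ht : H.faceOf d ≠ H.faceOf (H.rot⁻¹ dt))
    (hz : (H.cut p ds dt).face.SameCycle (H.cutLift p d) z) :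
    ∃ e, H.faceOf e = H.faceOf d ∧ H.cutLift p e = z := by
  refine mem_of_sameCycle (S := {z | ∃ e, H.faceOf e = H.faceOf d ∧ H.cutLift p e = z})
    ?_ hz ⟨d, rfl, rfl⟩
  rintro _ ⟨e, he, rfl⟩
  refine ⟨H.face e, by rw [faceOf_face, he], (h.cut_face_cutLift ?_ ?_).symm⟩
  · exact fun hc => hs (by rw [← he, ← faceOf_face, hc])
  · exact fun hc => ht (by rw [← he, ← faceOf_face, hc])

/-- Faces away from the two ends of the cut lift unchanged and remain distinct. Only the faces at ds
and dt may be identified, so setting the first apart as `none` leaves an injection. -/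
theorem card_face (h : H.IsCutPath p ds dt) :
    Nat.card H.Face ≤ Nat.card (H.cut p ds dt).Face + 1 := by
  classical
  have hex : ∀ f : H.Face, ∃ d, H.faceOf d = f := Quotient.exists_rep
  choose g hg using hex
  have key : ∀ f f', f ≠ H.faceOf (H.rot⁻¹ ds) → f ≠ H.faceOf (H.rot⁻¹ dt) →
      (H.cut p ds dt).faceOf (H.cutLift p (g f)) = (H.cut p ds dt).faceOf (H.cutLift p (g f')) →
      f = f' := by
    intro f f' hs ht hff
    obtain ⟨e, he, hz⟩ := h.exists_cutLift_of_sameCycle (by rwa [hg]) (by rwa [hg])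
      (faceOf_eq_faceOf.1 hff)
    rw [← hg f, ← he, cutLift_injective hz, hg]
  have hinj : Function.Injective fun f : H.Face => if f = H.faceOf (H.rot⁻¹ ds) then none else
      some ((H.cut p ds dt).faceOf (H.cutLift p (g f))) := by
    intro f f' hff
    dsimp only at hff
    split_ifs at hff with h1 h2 h2
    · rw [h1, h2]
    · have hff := Option.some_injective _ hff
      by_cases ht : f = H.faceOf (H.rot⁻¹ dt)
      · by_cases ht' : f' = H.faceOf (H.rot⁻¹ dt)
        · rw [ht, ht']
        · exact (key f' f h2 ht' hff.symm).symm
      · exact key f f' h1 ht hff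
  have := Nat.card_le_card_of_injective _ hinj
  rwa [Finite.card_option] at this

theorem card_edge (H : CombMap D) (p : List D) (ds dt : D) :
    Nat.card (H.cut p ds dt).Edge ≤ Nat.card H.Edge + p.length := by
  have h1 := two_mul_card_edge (H.cut p ds dt)
  have h2 := two_mul_card_edge H
  rw [Nat.card_sum] at h1
  have h3 : Nat.card (H.PathDart p) ≤ Nat.card (Fin p.length ⊕ Fin p.length) := by
    refine Nat.card_le_card_of_surjective (Sum.elim
      (fun m => ⟨p.get m, Or.inl (List.get_mem p m)⟩)
      fun m => ⟨H.rev (p.get m), Or.inr (by rw [H.rev_rev]; exact List.get_mem p m)⟩) ?_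
    rintro ⟨d, hd | hd⟩
    · obtain ⟨m, hm⟩ := List.get_of_mem hd
      exact ⟨Sum.inl m, Subtype.ext hm⟩
    · obtain ⟨m, hm⟩ := List.get_of_mem hd
      exact ⟨Sum.inr m, Subtype.ext ((congrArg H.rev hm).trans (H.rev_rev d))⟩
  rw [Nat.card_sum, Nat.card_fin] at h3
  omega

theorem isSlit (h : H.IsCutPath p ds dt) (hH : H.Connected)
    (hE : Nat.card H.Edge + 2 ≤ Nat.card H.Vert + Nat.card H.Face) :
    (H.cut p ds dt).IsSlit (H.leave p dt) (H.enter p ds) where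
  connected := h.cut_connected hH
  euler := by
    have h1 := h.card_vert
    have h2 := h.card_face
    have h3 := card_edge H p ds dt
    omega
  face_L := h.cut_face_leave
  face_E := h.cut_face_enter
  sameCycle := h.sameCycle
  injective_L := h.leave_injective
  injective_E := h.enter_injective
  ne := h.leave_ne_enter

end IsCutPath

end Cut

end CombMap

/-- `M` is a connected plane graph; `ds` and `dt` are darts at the distinct vertices `s` and `t`, and
they select the faces `f_s`, `f_t` on their left, with a corner of `f_s` at `s` and a corner of `f_t`
at `t`; `p` is a shortest path from `f_s` to `f_t` in the dual graph. -/
theorem lemma2 {D : Type*} [Fintype D] (M : CombMap D) (hM : M.IsPlane)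
    (ds dt : D) (hst : M.tail ds ≠ M.tail dt)
    (p : List D) (hp : M.dual.IsShortest (M.dual.tail ds) p (M.dual.tail dt))
    (i : Fin (p.length + 1)) (hi : i ∈ M.dual.minIndices p ds dt) :
    (∀ j, i < j → ∀ l,
      (M.dual.cut p ds dt).IsShortest (M.dual.x p ds dt j) l (M.dual.y p ds dt j) →
      (M.dual.rightPart p ds dt i ∪ M.dual.middlePart p ds dt i).IsWalk
        (M.dual.x p ds dt j) l (M.dual.y p ds dt j)) ∧
    (∀ u ∈ (M.dual.rightPart p ds dt i).verts, ∀ v ∈ (M.dual.rightPart p ds dt i).verts,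
      (M.dual.rightPart p ds dt i ∪ M.dual.middlePart p ds dt i).dist u v =
        (M.dual.rightPart p ds dt i).dist u v) ∧
    (∀ j u v A B C,
      (M.dual.cut p ds dt).IsWalk (M.dual.x p ds dt j) A u →
      (M.dual.middlePart p ds dt i).IsWalk u B v →
      (M.dual.cut p ds dt).IsWalk v C (M.dual.y p ds dt j) →
      (M.dual.cut p ds dt).IsShortest
        (M.dual.x p ds dt j) (A ++ B ++ C) (M.dual.y p ds dt j) →
      ∃ A' C',
        (M.dual.cut p ds dt).IsWalk (M.dual.x p ds dt i) A' u ∧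
        (M.dual.cut p ds dt).IsWalk v C' (M.dual.y p ds dt i) ∧
        (M.dual.cut p ds dt).IsShortest
          (M.dual.x p ds dt i) (A' ++ B ++ C') (M.dual.y p ds dt i)) := by
  -- These dual faces are the vertices s and t.
  have hst' : M.dual.faceOf (M.dual.rot⁻¹ ds) ≠ M.dual.faceOf (M.dual.rot⁻¹ dt) := by
    intro hc
    have := CombMap.apply_eq_of_sameCycle (CombMap.head_dual_face M) (CombMap.faceOf_eq_faceOf.1 hc)
    rw [CombMap.head_dual_rot_inv, CombMap.head_dual_rot_inv] at this
    exact hst this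
  have hcut : M.dual.IsCutPath p ds dt := ⟨hp.1, hp.nodup_support, hst'⟩
  have hS := hcut.isSlit hM.1.dual hM.dual_euler
  have hr := CombMap.bfsPath_isShortest (r := (M.dual.cut p ds dt).rot (M.dual.leave p dt i))
    (v := M.dual.y p ds dt i) CombMap.sameCycle_rot_inv hS.connected
  have := Fintype.ofFinite (M.dual.CutDart p)
  obtain ⟨h1, h3⟩ := hS.shortest_paths i
  exact ⟨h1, fun u hu v hv => CombMap.dist_union_side_eq hr _ hu hv, h3⟩
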